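/- Let $d\ge 1$, let $G\subset\mathbb R^d$ be a (Lebesgue measurable) set with nonempty interior, and let $r\in\mathbb N_0$. For $1\le p\le\infty$ let $W_p^r(G)$ be the Sobolev space of functions $f\in L_p(G)$ whose weak derivatives satisfy $$\|f\|_{W_p^r(G)}=\Bigl(\sum_{\alpha\in\mathbb N_0^d,\ |\alpha|_1\le r}\|D^\alpha f\|_{L_p(G)}^p\Bigr)^{1/p}<\infty$$ (a maximum if $p=\infty$; derivatives of positive order are taken on the interior of $G$), where only those $f$ are admitted as inputs for which $\operatorname{INT}f=\int_G f(x)\,dx$ exists. A randomized algorithm $A_n=(A_n^\omega)_{\omega\in\Omega}$ with $n$ function values is indexed by a probability space $(\Omega,\Sigma,\mathbb P)$; for each $\omega$ it observes $y_i=f(x_i^\omega)$, $i=1,\dots,n$, at points $x_i^\omega\in G$, where $x_i^\omega$ may depend on the previously observed values $y_1,\dots,y_{i-1}$ (adaptive algorithms are allowed), and returns $A_n^\omega(f)=\phi^\omega(y_1,\dots,y_n)$ with an arbitrary $\phi^\omega:\mathbb R^n\to\mathbb R$; the error $\omega\mapsto|A_n^\omega(f)-\operatorname{INT}f|$ is required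 to be measurable for every input $f$. Let $e^{\mathrm{MC}}_{\mathrm{prob}}(n,\delta,W_p^r(G))\in[0,\infty]$ be the infimum of all $\varepsilon>0$ for which there is such an algorithm with $$\mathbb P\{|A_n(f)-\operatorname{INT}f|>\varepsilon\}\le\delta\qquad\text{for all inputs } f \text{ with } \|f\|_{W_p^r(G)}\le 1.$$ Then there are $n_0\in\mathbb N$, $\delta_0\in(0,1)$ and $c>0$, depending only on $d$, $r$ and $G$, such that for all $1\le p\le\infty$, with $q:=\min\{p,2\}$, all $n\ge n_0$ and all $\delta\in(0,\delta_0)$, $$e^{\mathrm{MC}}_{\mathrm{prob}}(n,\delta,W_p^r(G))\ \ge\ c\,\min\Bigl\{n^{-r/d},\ n^{-(r/d+1-1/q)}\,(\log\delta^{-1})^{1-1/q}\Bigr\}.$$ The same bound holds if the inputs are restricted to the functions in $W_p^r(G)$ that are continuous on $G$. -/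

import Mathlib

open MeasureTheory Set
open scoped ENNReal

universe u

/-! ### Sobolev spaces of integer smoothness on subsets of `ℝ^d`

Points of `ℝ^d` are functions `Fin d → ℝ`; `volume` is the `d`-dimensional Lebesgue measure. -/

/-- The partial derivative `∂φ/∂x_i`. -/
noncomputable def partialD {d : ℕ} (i : Fin d) (φ : (Fin d → ℝ) → ℝ) : (Fin d → ℝ) → ℝ :=
  fun x => fderiv ℝ φ x (Pi.single i 1)

/-- The classical derivative `D^α φ = ∂_{x_1}^{α_1} ⋯ ∂_{x_d}^{α_d} φ` (used for smooth `φ`). -/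
noncomputable def multiD {d : ℕ} (α : Fin d → ℕ) (φ : (Fin d → ℝ) → ℝ) : (Fin d → ℝ) → ℝ :=
  (List.finRange d).foldr (fun i ψ => (partialD i)^[α i] ψ) φ

/-- The finite set of multi-indices `α ∈ ℕ_0^d` with `|α|_1 ≤ r`. -/
def multiIndices (d r : ℕ) : Finset (Fin d → ℕ) :=
  (Fintype.piFinset fun _ => Finset.range (r + 1)).filter fun α => ∑ i, α i ≤ r

theorem mem_multiIndices {d r : ℕ} {α : Fin d → ℕ} :
    α ∈ multiIndices d r ↔ ∑ i, α i ≤ r := by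
  simp only [multiIndices, Finset.mem_filter, Fintype.mem_piFinset, Finset.mem_range,
    and_iff_right_iff_imp]
  intro h i
  have := Finset.single_le_sum (f := α) (fun _ _ => Nat.zero_le _) (Finset.mem_univ i)
  omega

/-- `g` is a weak derivative `D^α f` on the open set `U`. -/
def IsWeakDeriv {d : ℕ} (U : Set (Fin d → ℝ)) (α : Fin d → ℕ) (f g : (Fin d → ℝ) → ℝ) : Prop :=
  LocallyIntegrableOn f U ∧ LocallyIntegrableOn g U ∧
    ∀ φ : (Fin d → ℝ) → ℝ, ContDiff ℝ (⊤ : ℕ∞) φ → HasCompactSupport φ → tsupport φ ⊆ U →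
      ∫ x in U, f x * multiD α φ x = (-1) ^ (∑ i, α i) * ∫ x in U, g x * φ x

/-- `g` lists the derivatives of `f` up to order `r`: `g 0 = f`, and for `0 < |α|_1 ≤ r` the
function `g α` is a weak derivative `D^α f` on the interior of `G`. -/
def IsWeakDerivFamily {d : ℕ} (r : ℕ) (G : Set (Fin d → ℝ)) (f : (Fin d → ℝ) → ℝ)
    (g : (Fin d → ℕ) → (Fin d → ℝ) → ℝ) : Prop :=
  g 0 = f ∧ ∀ α ∈ multiIndices d r, α ≠ 0 → IsWeakDeriv (interior G) α f (g α)

/-- `(∑_{a ∈ s} v_a ^ p)^{1/p}` for `p < ∞`, and `max_{a ∈ s} v_a` for `p = ∞`. -/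
noncomputable def lpSum {ι : Type*} (p : ℝ≥0∞) (s : Finset ι) (v : ι → ℝ≥0∞) : ℝ≥0∞ :=
  if p = ⊤ then s.sup v else (∑ a ∈ s, v a ^ p.toReal) ^ (1 / p.toReal)

/-- The norm `‖f‖_{W_p^r(G)} = (∑_{|α|_1 ≤ r} ‖D^α f‖_{L_p}^p)^{1/p}` (a maximum for `p = ∞`),
with value `∞` if some weak derivative does not exist. Weak derivatives are unique up to null sets,
so that the infimum runs over one value at most. The set `G` need not be open: `f` itself is
measured on `G`, and the derivatives of positive order, which test functions determine on the
interior only, are measured there. -/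
noncomputable def sobolevNorm {d : ℕ} (r : ℕ) (p : ℝ≥0∞) (G : Set (Fin d → ℝ))
    (f : (Fin d → ℝ) → ℝ) : ℝ≥0∞ :=
  ⨅ (g : (Fin d → ℕ) → (Fin d → ℝ) → ℝ) (_ : IsWeakDerivFamily r G f g),
    lpSum p (multiIndices d r) fun α =>
      eLpNorm (g α) p (volume.restrict (if α = 0 then G else interior G))

/-- The functions of `W_p^r(G)` whose integral over `G` exists (all of them if `G` has finite
measure, or if `p = 1`). The elements are functions, not classes, since they are to be evaluated at
points; only the values on `G` matter. -/
def sobolevSpace {d : ℕ} (r : ℕ) (p : ℝ≥0∞) (G : Set (Fin d → ℝ)) : Set ((Fin d → ℝ) → ℝ) :=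
  {f | MemLp f p (volume.restrict G) ∧ sobolevNorm r p G f < ⊤ ∧ IntegrableOn f G}

/-- The functions of `W_p^r(G)` that are continuous on `G`. -/
def continuousSobolevSpace {d : ℕ} (r : ℕ) (p : ℝ≥0∞) (G : Set (Fin d → ℝ)) :
    Set ((Fin d → ℝ) → ℝ) :=
  {f | f ∈ sobolevSpace r p G ∧ ContinuousOn f G}

/-! ### Randomized algorithms and the probabilistic error -/

/-- A randomized, possibly adaptive algorithm that uses `n` function values at points of `G`. For
the random element `ω`, after `k` values `y_1, …, y_k` have been observed, the next one is taken at
`node ω k (y_1, …, y_k)`; from the `n` values the result is computed by `output ω`. The algorithm is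
non-adaptive if `node ω k` is constant for all `ω` and `k`. -/
structure MCAlgorithm {d : ℕ} (G : Set (Fin d → ℝ)) (n : ℕ) (Ω : Type*) where
  node : Ω → (k : ℕ) → (Fin k → ℝ) → G
  output : Ω → (Fin n → ℝ) → ℝ

namespace MCAlgorithm

/-- The first `k` observed values. -/
def info {d : ℕ} {G : Set (Fin d → ℝ)} {n : ℕ} {Ω : Type*} (A : MCAlgorithm G n Ω) (ω : Ω)
    (f : (Fin d → ℝ) → ℝ) : (k : ℕ) → Fin k → ℝ
  | 0 => Fin.elim0
  | k + 1 => Fin.snoc (α := fun _ => ℝ) (A.info ω f k) (f (A.node ω k (A.info ω f k)))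

/-- The result `A^ω(f)`. -/
def run {d : ℕ} {G : Set (Fin d → ℝ)} {n : ℕ} {Ω : Type*} (A : MCAlgorithm G n Ω) (ω : Ω)
    (f : (Fin d → ℝ) → ℝ) : ℝ :=
  A.output ω (A.info ω f n)

/-- `|A^ω(f) - ∫_G f|`. -/
noncomputable def error {d : ℕ} {G : Set (Fin d → ℝ)} {n : ℕ} {Ω : Type*} (A : MCAlgorithm G n Ω)
    (f : (Fin d → ℝ) → ℝ) (ω : Ω) : ℝ :=
  |A.run ω f - ∫ x in G, f x|

/-- `A` is an algorithm on the space `𝓦` (its error is measurable for every input) which is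
`(ε, δ)`-approximating for the inputs of norm at most one. -/
def IsApproximating {d : ℕ} {G : Set (Fin d → ℝ)} {n : ℕ} {Ω : Type*} [MeasurableSpace Ω]
    (A : MCAlgorithm G n Ω) (P : Measure Ω) (𝓦 : Set ((Fin d → ℝ) → ℝ))
    (norm : ((Fin d → ℝ) → ℝ) → ℝ≥0∞) (ε δ : ℝ) : Prop :=
  (∀ f ∈ 𝓦, Measurable (A.error f)) ∧
    ∀ f ∈ 𝓦, norm f ≤ 1 → P {ω | ε < A.error f ω} ≤ ENNReal.ofReal δ

end MCAlgorithm

/-- The `n`-th minimal probabilistic Monte Carlo error at uncertainty `δ` for integration over `G`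
of functions from the unit ball of `𝓦`: the infimum of all `ε > 0` for which there is an
`(ε, δ)`-approximating algorithm with `n` function values (`∞` if there is none). -/
noncomputable def probError {d : ℕ} (G : Set (Fin d → ℝ)) (n : ℕ) (δ : ℝ)
    (𝓦 : Set ((Fin d → ℝ) → ℝ)) (norm : ((Fin d → ℝ) → ℝ) → ℝ≥0∞) : ℝ≥0∞ :=
  sInf {e : ℝ≥0∞ | ∃ ε : ℝ, 0 < ε ∧ e = ENNReal.ofReal ε ∧
    ∃ (Ω : Type u) (_ : MeasurableSpace Ω) (P : Measure Ω) (_ : IsProbabilityMeasure P)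
      (A : MCAlgorithm G n Ω), A.IsApproximating P 𝓦 norm ε δ}

/-- `min {n^{-r/d}, n^{-(r/d + 1 - 1/q)} (log δ⁻¹)^{1 - 1/q}}` with `q = min {p, 2}`. -/
noncomputable def lowerRate (d r : ℕ) (p : ℝ≥0∞) (n : ℕ) (δ : ℝ) : ℝ :=
  let q : ℝ := (min p 2).toReal
  min ((n : ℝ) ^ (-((r : ℝ) / d)))
    ((n : ℝ) ^ (-((r : ℝ) / d + 1 - 1 / q)) * Real.log δ⁻¹ ^ (1 - 1 / q))

/-!
The hard inputs are signed sums of `2 n` disjoint bumps of width of order `n ^ (-1 / d)`, whose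
signs are independent and nonzero with probability `ρ`. An adaptive algorithm sees at most `n` of
the bumps, and resampling or negating the unseen signs preserves both their law and the output.
Hence, up to a factor `1 / 2`, the algorithm errs as often as the sum of the unseen signs is
large.

Split `n` unseen signs into `k` blocks of length `m = ⌊n / k⌋`. By the Paley–Zygmund inequality
each block sum exceeds `√(m ρ) / 2` with probability at least `1 / 32`, up to harmless constraints
on the number of nonzero signs, so the whole sum exceeds `k √(m ρ) / 2` with probability of order
`32⁻ᵏ`. Taking `k` proportional to `log δ⁻¹` (at most `n`) makes this larger than `δ`. The density
is `ρ = 1 / m` for `p ≤ 2`, so that each block has about one active bump, and `ρ = 1` for `p ≥ 2`.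
-/

section Resampling

variable {ι α : Type*} [DecidableEq ι]

/-- A rule that selects the observed coordinates of a word one after the other: the selection
depends on the word only through the letters at the selected places. -/
def IsAdaptive (I : (ι → α) → Finset ι) : Prop :=
  ∀ s s' : ι → α, (∀ i ∈ I s, s' i = s i) → I s' = I s

/-- Exchanges the letters of two words outside the observed coordinates of the first one. -/
def swapUnobserved (I : (ι → α) → Finset ι) (z : (ι → α) × (ι → α)) : (ι → α) × (ι → α) :=
  ((I z.1).piecewise z.1 z.2, (I z.1).piecewise z.2 z.1)

theorem IsAdaptive.apply_piecewise {I : (ι → α) → Finset ι} (hI : IsAdaptive I) (s u : ι → α) :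
    I ((I s).piecewise s u) = I s :=
  hI s _ fun _ hi => Finset.piecewise_eq_of_mem _ _ _ hi

theorem IsAdaptive.involutive_swapUnobserved {I : (ι → α) → Finset ι} (hI : IsAdaptive I) :
    Function.Involutive (swapUnobserved I) := by
  rintro ⟨s, u⟩
  ext i
  · by_cases hi : i ∈ I s <;> simp [swapUnobserved, hI.apply_piecewise, hi]
  · by_cases hi : i ∈ I s <;> simp [swapUnobserved, hI.apply_piecewise, hi]

variable [Fintype ι] [Countable α] [MeasurableSpace α] [DiscreteMeasurableSpace α]
  (μ : ι → Measure α) [∀ i, IsProbabilityMeasure (μ i)]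

theorem IsAdaptive.measurePreserving_swapUnobserved {I : (ι → α) → Finset ι} (hI : IsAdaptive I) :
    MeasurePreserving (swapUnobserved I) ((Measure.pi μ).prod (Measure.pi μ))
      ((Measure.pi μ).prod (Measure.pi μ)) := by
  refine ⟨.of_discrete, Measure.ext_of_singleton fun z => ?_⟩
  have hpre : swapUnobserved I ⁻¹' {z} = {swapUnobserved I z} :=
    Set.ext fun y => hI.involutive_swapUnobserved.eq_iff
  rw [Measure.map_apply .of_discrete .of_discrete, hpre]
  have hpair : ∀ s u : ι → α, (Measure.pi μ).prod (Measure.pi μ) {(s, u)} =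
      ∏ i, μ i {s i} * μ i {u i} := fun s u => by
    rw [← Set.singleton_prod_singleton, Measure.prod_prod, Measure.pi_singleton,
      Measure.pi_singleton, Finset.prod_mul_distrib]
  obtain ⟨s, u⟩ := z
  rw [swapUnobserved, hpair, hpair]
  refine Finset.prod_congr rfl fun i _ => ?_
  by_cases hi : i ∈ I s
  · simp only [Finset.piecewise_eq_of_mem _ _ _ hi]
  · simp only [Finset.piecewise_eq_of_notMem _ _ _ hi, mul_comm]

theorem IsAdaptive.measurePreserving_resample {I : (ι → α) → Finset ι} (hI : IsAdaptive I) :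
    MeasurePreserving (fun z : (ι → α) × (ι → α) => (I z.1).piecewise z.1 z.2)
      ((Measure.pi μ).prod (Measure.pi μ)) (Measure.pi μ) :=
  measurePreserving_fst.comp (hI.measurePreserving_swapUnobserved μ)

end Resampling

section PaleyZygmund

variable {Ω : Type*} [MeasurableSpace Ω] {P : Measure Ω}

theorem sq_integral_le_measureReal_mul_integral_sq [IsFiniteMeasure P] {Z : Ω → ℝ}
    (hZ : MemLp Z 2 P) : (∫ ω, Z ω ∂P) ^ 2 ≤ P.real univ * ∫ ω, Z ω ^ 2 ∂P := by
  have hint := hZ.integrable one_le_two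
  set m := P.real univ
  set e := ∫ ω, Z ω ∂P
  rcases measureReal_nonneg.eq_or_lt with hm | hm
  · have hP : P = 0 := Measure.measure_univ_eq_zero.1 ((measureReal_eq_zero_iff).1 hm.symm)
    simp [e, hP]
  · have hquad : ∫ ω, (m * Z ω - e) ^ 2 ∂P = m * (m * ∫ ω, Z ω ^ 2 ∂P - e ^ 2) := by
      have hexp : ∀ ω, (m * Z ω - e) ^ 2 = m ^ 2 * Z ω ^ 2 - 2 * m * e * Z ω + e ^ 2 :=
        fun ω => by ring
      have hsq := hZ.integrable_sq
      simp_rw [hexp]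
      rw [integral_add (by fun_prop) (by fun_prop), integral_sub (by fun_prop) (by fun_prop),
        integral_const_mul, integral_const_mul, integral_const, smul_eq_mul]
      ring
    have hnonneg : 0 ≤ m * (m * ∫ ω, Z ω ^ 2 ∂P - e ^ 2) :=
      hquad ▸ integral_nonneg fun ω => sq_nonneg _
    exact sub_nonneg.1 (nonneg_of_mul_nonneg_right hnonneg hm)

theorem paley_zygmund [IsProbabilityMeasure P] {Z : Ω → ℝ} (hZm : Measurable Z)
    (hZ : MemLp Z 2 P) {θ : ℝ} (hθ : 0 ≤ θ) (hθ1 : θ ≤ 1)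
    (hZ0 : 0 ≤ ∫ ω, Z ω ∂P) :
    ((1 - θ) * ∫ ω, Z ω ∂P) ^ 2 ≤
      P.real {ω | θ * ∫ ω, Z ω ∂P ≤ Z ω} * ∫ ω, Z ω ^ 2 ∂P := by
  set m := ∫ ω, Z ω ∂P
  set A := {ω | θ * m ≤ Z ω}
  have hint := hZ.integrable one_le_two
  have hAm : MeasurableSet A := measurableSet_le measurable_const hZm
  have hfirst : (1 - θ) * m ≤ ∫ ω in A, Z ω ∂P := by
    have hle : m ≤ ∫ ω, θ * m + A.indicator Z ω ∂P :=
      integral_mono hint ((integrable_const _).add (hint.indicator hAm)) fun ω => by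
        by_cases hω : ω ∈ A
        · simpa [hω] using mul_nonneg hθ hZ0
        · simpa [hω] using (not_le.1 hω).le
    rw [integral_add (integrable_const _) (hint.indicator hAm), integral_indicator hAm] at hle
    simp only [integral_const, probReal_univ, one_smul] at hle
    linarith
  calc ((1 - θ) * m) ^ 2 ≤ (∫ ω in A, Z ω ∂P) ^ 2 :=
        pow_le_pow_left₀ (mul_nonneg (sub_nonneg.2 hθ1) hZ0) hfirst 2
    _ ≤ P.real A * ∫ ω in A, Z ω ^ 2 ∂P := by
        simpa using sq_integral_le_measureReal_mul_integral_sq (hZ.restrict A)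
    _ ≤ P.real A * ∫ ω, Z ω ^ 2 ∂P :=
        mul_le_mul_of_nonneg_left
          (setIntegral_le_integral hZ.integrable_sq (.of_forall fun ω => sq_nonneg _))
          measureReal_nonneg

end PaleyZygmund

section Moments

open ProbabilityTheory

variable {Ω : Type*} [MeasurableSpace Ω] {P : Measure Ω} [IsProbabilityMeasure P]

theorem integral_add_pow_four_of_indepFun {X Y : Ω → ℝ} (hX : MemLp X 4 P) (hY : MemLp Y 4 P)
    (hXY : IndepFun X Y P) (hX0 : ∫ ω, X ω ∂P = 0) (hY0 : ∫ ω, Y ω ∂P = 0) :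
    ∫ ω, (X ω + Y ω) ^ 4 ∂P = ∫ ω, X ω ^ 4 ∂P +
      6 * ((∫ ω, X ω ^ 2 ∂P) * ∫ ω, Y ω ^ 2 ∂P) + ∫ ω, Y ω ^ 4 ∂P := by
  have hpow {Z : Ω → ℝ} (hZ : MemLp Z 4 P) (a : ℕ) (ha : a ≤ 4) :
      Integrable (fun ω => Z ω ^ a) P :=
    (integrable_norm_iff (hZ.1.pow a)).1 (by
      simpa only [Pi.pow_apply, norm_pow] using
        (hZ.mono_exponent (mod_cast ha)).integrable_norm_pow')
  have hind (a b : ℕ) : IndepFun (fun ω => X ω ^ a) (fun ω => Y ω ^ b) P :=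
    hXY.comp (measurable_id.pow_const a) (measurable_id.pow_const b)
  have hint (a b : ℕ) (ha : a ≤ 4) (hb : b ≤ 4) : Integrable (fun ω => X ω ^ a * Y ω ^ b) P :=
    (hind a b).integrable_mul (hpow hX a ha) (hpow hY b hb)
  have hprod (a b : ℕ) :
      ∫ ω, X ω ^ a * Y ω ^ b ∂P = (∫ ω, X ω ^ a ∂P) * ∫ ω, Y ω ^ b ∂P :=
    (hind a b).integral_fun_mul_eq_mul_integral (hX.1.pow a) (hY.1.pow b)
  have hexp (ω : Ω) : (X ω + Y ω) ^ 4 =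
      ∑ j ∈ Finset.range 5, (X ω ^ j * Y ω ^ (4 - j)) * Nat.choose 4 j := add_pow _ _ _
  simp_rw [hexp]
  rw [integral_finsetSum _ fun j hj => (hint j (4 - j) (by grind) (by omega)).mul_const _]
  simp only [integral_mul_const, hprod, Finset.sum_range_succ]
  simp only [Finset.range_zero, Finset.sum_empty, pow_zero, integral_const, probReal_univ,
    smul_eq_mul, mul_one, tsub_zero, one_mul, Nat.choose, Nat.cast_one, zero_add, pow_one, hX0,
    Nat.add_one_sub_one, zero_mul, add_zero, Nat.reduceAdd, Nat.cast_ofNat, Nat.reduceSub, hY0,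
    mul_zero, tsub_self]
  ring

variable {ι : Type*} {X : ι → Ω → ℝ}

theorem integral_sum_sq_of_iIndepFun (hX : ∀ i, MemLp (X i) 2 P) (hind : iIndepFun X P)
    (hX0 : ∀ i, ∫ ω, X i ω ∂P = 0) (F : Finset ι) :
    ∫ ω, (∑ i ∈ F, X i ω) ^ 2 ∂P = ∑ i ∈ F, ∫ ω, X i ω ^ 2 ∂P := by
  have hsum : ∫ ω, (∑ i ∈ F, X i) ω ∂P = 0 := by
    simp_rw [Finset.sum_apply]
    rw [integral_finsetSum _ fun i _ => (hX i).integrable one_le_two, Finset.sum_eq_zero]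
    exact fun i _ => hX0 i
  have hvar := IndepFun.variance_sum (s := F) (fun i _ => hX i) fun i _ j _ hij => hind.indepFun hij
  rw [variance_of_integral_eq_zero (memLp_finsetSum' F fun i _ => hX i).1.aemeasurable hsum] at hvar
  simp only [Finset.sum_apply] at hvar
  rw [hvar]
  exact Finset.sum_congr rfl fun i _ =>
    variance_of_integral_eq_zero (hX i).1.aemeasurable (hX0 i)

theorem integral_sum_pow_four_le_of_iIndepFun (hXm : ∀ i, Measurable (X i))
    (hX : ∀ i, MemLp (X i) 4 P) (hind : iIndepFun X P) (hX0 : ∀ i, ∫ ω, X i ω ∂P = 0)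
    (F : Finset ι) :
    ∫ ω, (∑ i ∈ F, X i ω) ^ 4 ∂P ≤
      ∑ i ∈ F, ∫ ω, X i ω ^ 4 ∂P + 3 * (∑ i ∈ F, ∫ ω, X i ω ^ 2 ∂P) ^ 2 := by
  classical
  have hX2 (i : ι) : MemLp (X i) 2 P := (hX i).mono_exponent (by norm_num)
  induction F using Finset.induction_on with
  | empty => simp
  | insert i F hi ih =>
    have hsum := integral_add_pow_four_of_indepFun (hX i)
      (memLp_finsetSum F fun j _ => hX j)
      (by simpa [Finset.sum_fn] using (hind.indepFun_finsetSum_of_notMem hXm hi).symm) (hX0 i)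
      (by rw [integral_finsetSum _ fun j _ => (hX j).integrable (by norm_num)]; simp [hX0])
    have hsq := integral_sum_sq_of_iIndepFun hX2 hind hX0 F
    simp only [Finset.sum_insert hi]
    rw [hsum, hsq]
    nlinarith [sq_nonneg (∫ ω, X i ω ^ 2 ∂P)]

end Moments

section RandomSigns

open ProbabilityTheory

instance : MeasurableSpace SignType := ⊤

instance : DiscreteMeasurableSpace SignType := ⟨fun _ => trivial⟩

/-- The law of a random sign that is nonzero with probability `ρ`. -/
noncomputable def signLaw (ρ : unitInterval) : Measure SignType :=
  unitInterval.toNNReal (unitInterval.symm ρ) • Measure.dirac 0 +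
    (unitInterval.toNNReal ρ / 2) • (Measure.dirac 1 + Measure.dirac (-1))

theorem integral_signLaw (ρ : unitInterval) (f : SignType → ℝ) :
    ∫ a, f a ∂signLaw ρ = (1 - ρ) * f 0 + ρ / 2 * (f 1 + f (-1)) := by
  rw [signLaw, integral_add_measure .of_finite .of_finite, integral_smul_nnreal_measure,
    integral_smul_nnreal_measure, integral_add_measure .of_finite .of_finite]
  simp only [integral_dirac, NNReal.smul_def, unitInterval.coe_toNNReal,
    unitInterval.coe_symm_eq, smul_eq_mul, smul_add, NNReal.coe_div, NNReal.coe_ofNat]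
  ring

instance (ρ : unitInterval) : IsProbabilityMeasure (signLaw ρ) := by
  have : IsFiniteMeasure (signLaw ρ) := by unfold signLaw; infer_instance
  refine isProbabilityMeasure_iff_real.2 ?_
  have h := integral_signLaw ρ fun _ => 1
  rw [integral_const, smul_eq_mul, mul_one] at h
  rw [h]
  ring

theorem map_neg_signLaw (ρ : unitInterval) : (signLaw ρ).map Neg.neg = signLaw ρ := by
  have hm : Measurable (Neg.neg : SignType → SignType) := .of_discrete
  rw [signLaw, Measure.map_add _ _ hm, Measure.map_smul, Measure.map_smul, Measure.map_add _ _ hm,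
    Measure.map_dirac, Measure.map_dirac, Measure.map_dirac, neg_zero, neg_neg,
    add_comm (Measure.dirac 1)]

variable {ι : Type*} [Fintype ι]

/-- The law of a word of independent random signs. -/
noncomputable def signWordLaw (ι : Type*) [Fintype ι] (ρ : unitInterval) : Measure (ι → SignType) :=
  Measure.pi fun _ => signLaw ρ

instance (ρ : unitInterval) : IsProbabilityMeasure (signWordLaw ι ρ) :=
  inferInstanceAs (IsProbabilityMeasure (Measure.pi _))

theorem measurePreserving_neg_signWordLaw (ρ : unitInterval) :
    MeasurePreserving Neg.neg (signWordLaw ι ρ) (signWordLaw ι ρ) :=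
  measurePreserving_pi _ _ fun _ => ⟨.of_discrete, map_neg_signLaw ρ⟩

theorem iIndepFun_coe_signWordLaw (ρ : unitInterval) :
    iIndepFun (fun i (s : ι → SignType) => (s i : ℝ)) (signWordLaw ι ρ) :=
  iIndepFun_pi (X := fun _ => SignType.cast) fun _ => Measurable.of_discrete.aemeasurable

theorem integral_eval_signWordLaw (ρ : unitInterval) (i : ι) (f : SignType → ℝ) :
    ∫ s, f (s i) ∂signWordLaw ι ρ = (1 - ρ) * f 0 + ρ / 2 * (f 1 + f (-1)) :=
  (integral_comp_eval (μ := fun _ => signLaw ρ)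
    StronglyMeasurable.of_discrete.aestronglyMeasurable).trans (integral_signLaw ρ f)

end RandomSigns

section SignWords

open ProbabilityTheory

variable {ι : Type*} (F : Finset ι)

/-- The sum of the letters of a word of signs over the places in `F`. -/
def signSum (F : Finset ι) (s : ι → SignType) : ℝ :=
  ∑ i ∈ F, (s i : ℝ)

/-- The number of nonzero letters of a word of signs at the places in `F`. -/
def signWeight (F : Finset ι) (s : ι → SignType) : ℝ :=
  ∑ i ∈ F, |(s i : ℝ)|

theorem signSum_neg (s : ι → SignType) : signSum F (-s) = -signSum F s := by
  simp [signSum]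

theorem signWeight_neg (s : ι → SignType) : signWeight F (-s) = signWeight F s := by
  simp [signWeight]

/-- The words whose sum over the places in `F` is at least `t` although they have at most `w`
nonzero letters there. -/
def tailEvent (F : Finset ι) (t w : ℝ) : Set (ι → SignType) :=
  {s | t ≤ signSum F s ∧ signWeight F s ≤ w}

theorem tailEvent_mono {F : Finset ι} {t t' w w' : ℝ} (ht : t' ≤ t) (hw : w ≤ w') :
    tailEvent F t w ⊆ tailEvent F t' w' :=
  fun _ hs => ⟨ht.trans hs.1, hs.2.trans hw⟩

variable [Fintype ι] (ρ : unitInterval)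

theorem integral_signWeight : ∫ s, signWeight F s ∂signWordLaw ι ρ = F.card * ρ := by
  simp only [signWeight]
  rw [integral_finsetSum _ fun i _ => .of_finite]
  simp [integral_eval_signWordLaw ρ _ fun a => |(a : ℝ)|, one_add_one_eq_two]

theorem mul_measureReal_signWeight_le (a : ℝ) :
    a * (signWordLaw ι ρ).real {s | a ≤ signWeight F s} ≤ F.card * ρ := by
  rw [← integral_signWeight]
  exact mul_meas_ge_le_integral_of_nonneg (f := signWeight F)
    (.of_forall fun s => Finset.sum_nonneg fun i _ => abs_nonneg _) .of_finite a

theorem half_le_signWordLaw_signWeight_le {w : ℝ} (hw : 0 < w) (hF : 2 * (F.card * (ρ : ℝ)) ≤ w) :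
    2⁻¹ ≤ signWordLaw ι ρ {s | signWeight F s ≤ w} := by
  have hheavy : (signWordLaw ι ρ).real {s | w ≤ signWeight F s} ≤ 2⁻¹ :=
    le_of_mul_le_mul_left (by linarith [mul_measureReal_signWeight_le F ρ w]) hw
  have hcompl : 1 - (signWordLaw ι ρ).real {s | w ≤ signWeight F s} ≤
      (signWordLaw ι ρ).real {s | signWeight F s ≤ w} := by
    rw [← probReal_compl_eq_one_sub .of_discrete]
    exact measureReal_mono fun s (hs : ¬w ≤ signWeight F s) => le_of_not_ge hs
  rw [← ENNReal.ofReal_ofNat, ← ENNReal.ofReal_inv_of_pos two_pos]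
  exact ENNReal.ofReal_le_of_le_toReal (le_trans (by linarith) hcompl)

theorem integral_signSum_sq : ∫ s, signSum F s ^ 2 ∂signWordLaw ι ρ = F.card * ρ := by
  simp only [signSum]
  rw [integral_sum_sq_of_iIndepFun (fun _ => .of_discrete) (iIndepFun_coe_signWordLaw ρ)]
  · simp [integral_eval_signWordLaw ρ _ fun a => (a : ℝ) ^ 2, one_add_one_eq_two]
  · simp [integral_eval_signWordLaw ρ _ fun a => (a : ℝ)]

theorem integral_signSum_pow_four_le :
    ∫ s, signSum F s ^ 4 ∂signWordLaw ι ρ ≤ F.card * ρ + 3 * (F.card * ρ) ^ 2 := by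
  have h := integral_sum_pow_four_le_of_iIndepFun (fun _ => .of_discrete) (fun _ => .of_discrete)
    (iIndepFun_coe_signWordLaw (ι := ι) ρ)
    (by simp [integral_eval_signWordLaw ρ _ fun a => (a : ℝ)]) F
  simpa [integral_eval_signWordLaw ρ _ fun a => (a : ℝ) ^ 4,
    integral_eval_signWordLaw ρ _ fun a => (a : ℝ) ^ 2, one_add_one_eq_two,
    (by decide : Even 4).neg_one_pow, signSum] using h

theorem signWordLaw_tailEvent_mul_le [DecidableEq ι] {F F' : Finset ι} (hF : Disjoint F F')
    (t t' w w' : ℝ) :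
    signWordLaw ι ρ (tailEvent F t w) * signWordLaw ι ρ (tailEvent F' t' w') ≤
      signWordLaw ι ρ (tailEvent (F ∪ F') (t + t') (w + w')) := by
  have hind := (iIndepFun_coe_signWordLaw ρ).indepFun_finset F F' hF fun _ => .of_discrete
  let A (E : Finset ι) (t w : ℝ) : Set (E → ℝ) := {v | t ≤ ∑ i, v i ∧ ∑ i, |v i| ≤ w}
  have hA (E : Finset ι) (t w : ℝ) : MeasurableSet (A E t w) :=
    (measurableSet_le measurable_const (by fun_prop : Measurable fun v : E → ℝ => ∑ i, v i)).inter
      (measurableSet_le (by fun_prop : Measurable fun v : E → ℝ => ∑ i, |v i|) measurable_const)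
  have hpre (E : Finset ι) (t w : ℝ) :
      (fun (s : ι → SignType) (i : E) => (s i : ℝ)) ⁻¹' A E t w = tailEvent E t w := by
    ext s
    simp only [A, tailEvent, signSum, signWeight, mem_preimage, mem_ofPred_eq,
      Finset.sum_coe_sort E fun i => (s i : ℝ), Finset.sum_coe_sort E fun i => |(s i : ℝ)|]
  have hmul := hind.measure_inter_preimage_eq_mul _ _ (hA F t w) (hA F' t' w')
  rw [hpre, hpre] at hmul
  rw [← hmul]
  refine measure_mono fun s ⟨h, h'⟩ => ?_
  simp only [tailEvent, signSum, signWeight, mem_ofPred_eq, Finset.sum_union hF]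
  exact ⟨add_le_add h.1 h'.1, add_le_add h.2 h'.2⟩

variable {ρ : unitInterval} {F : Finset ι}

theorem le_measureReal_sq_signSum (hF : 1 ≤ F.card * (ρ : ℝ)) :
    9 / 64 ≤ (signWordLaw ι ρ).real {s | F.card * (ρ : ℝ) / 4 ≤ signSum F s ^ 2} := by
  set V := F.card * (ρ : ℝ)
  have hpz := paley_zygmund (P := signWordLaw ι ρ) (Z := fun s => signSum F s ^ 2) (θ := 1 / 4)
    .of_discrete .of_discrete (by norm_num) (by norm_num) (integral_nonneg fun _ => sq_nonneg _)
  simp only [integral_signSum_sq, ← pow_mul, one_div_mul_eq_div] at hpz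
  have hfourth : ∫ s, signSum F s ^ 4 ∂signWordLaw ι ρ ≤ 4 * V ^ 2 := by
    nlinarith [integral_signSum_pow_four_le F ρ]
  have hle := hpz.trans (mul_le_mul_of_nonneg_left hfourth measureReal_nonneg)
  exact le_of_mul_le_mul_right (by linarith) (by positivity : 0 < 4 * V ^ 2)

theorem le_measureReal_signSum (hF : 1 ≤ F.card * (ρ : ℝ)) :
    9 / 128 ≤ (signWordLaw ι ρ).real {s | √(F.card * ρ) / 2 ≤ signSum F s} := by
  set V := F.card * (ρ : ℝ)
  have hneg : (signWordLaw ι ρ).real {s | √V / 2 ≤ -signSum F s} =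
      (signWordLaw ι ρ).real {s | √V / 2 ≤ signSum F s} := by
    simp_rw [← signSum_neg]
    exact (measurePreserving_neg_signWordLaw (ι := ι) ρ).measureReal_preimage
      (s := {s | √V / 2 ≤ signSum F s}) MeasurableSet.of_discrete.nullMeasurableSet
  have hcover : {s : ι → SignType | V / 4 ≤ signSum F s ^ 2} ⊆
      {s | √V / 2 ≤ signSum F s} ∪ {s | √V / 2 ≤ -signSum F s} := fun s hs => by
    refine le_abs.1 (?_ : √V / 2 ≤ |signSum F s|)
    rw [← sq_le_sq₀ (by positivity) (abs_nonneg _), div_pow, Real.sq_sqrt (by positivity), sq_abs]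
    exact le_trans (by norm_num) hs
  have hunion := (measureReal_mono (μ := signWordLaw ι ρ) hcover).trans (measureReal_union_le _ _)
  linarith [le_measureReal_sq_signSum hF]

theorem le_signWordLaw_tailEvent_of_one_le (hF : 1 ≤ F.card * (ρ : ℝ)) :
    32⁻¹ ≤ signWordLaw ι ρ (tailEvent F (√(F.card * ρ) / 2) (64 * (F.card * ρ))) := by
  set V := F.card * (ρ : ℝ)
  have hheavy : (signWordLaw ι ρ).real {s | 64 * V ≤ signWeight F s} ≤ 1 / 64 := by
    have hmarkov := mul_measureReal_signWeight_le F ρ (64 * V)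
    exact le_of_mul_le_mul_left (by linarith) (by positivity : 0 < 64 * V)
  have hcover : {s : ι → SignType | √V / 2 ≤ signSum F s} ⊆
      tailEvent F (√V / 2) (64 * V) ∪ {s | 64 * V ≤ signWeight F s} :=
    fun s hs => (le_total (signWeight F s) (64 * V)).imp (fun h => ⟨hs, h⟩) id
  have hunion := (measureReal_mono (μ := signWordLaw ι ρ) hcover).trans (measureReal_union_le _ _)
  rw [← ENNReal.ofReal_ofNat, ← ENNReal.ofReal_inv_of_pos (by norm_num)]
  exact ENNReal.ofReal_le_of_le_toReal
    (show 32⁻¹ ≤ (signWordLaw ι ρ).real _ by linarith [le_measureReal_signSum hF])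

theorem pow_le_signWordLaw_tailEvent {k m : ℕ} (hm : 1 ≤ m * (ρ : ℝ)) (hk : 1 ≤ k)
    (hF : k * m ≤ F.card) :
    32⁻¹ ^ k ≤ signWordLaw ι ρ (tailEvent F (k * (√(m * ρ) / 2)) (64 * (F.card * ρ))) := by
  classical
  induction k, hk using Nat.le_induction generalizing F with
  | base =>
    rw [one_mul] at hF
    have hle : m * (ρ : ℝ) ≤ F.card * ρ := by have := ρ.2.1; gcongr
    rw [pow_one, Nat.cast_one, one_mul]
    exact (le_signWordLaw_tailEvent_of_one_le (hm.trans hle)).trans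
      (measure_mono (tailEvent_mono (by gcongr) le_rfl))
  | succ k _ ih =>
    obtain ⟨E, hEF, hE⟩ := Finset.exists_subset_card_eq (show m ≤ F.card by nlinarith)
    have hsdiff : F.card = E.card + (F \ E).card := by
      rw [Finset.card_sdiff_of_subset hEF]; have := Finset.card_le_card hEF; omega
    have hfirst := le_signWordLaw_tailEvent_of_one_le (F := E) (ρ := ρ) (by rwa [hE])
    have hrest := ih (F := F \ E) (by rw [add_mul] at hF; omega)
    have hmul := signWordLaw_tailEvent_mul_le ρ (Finset.disjoint_sdiff (s := E) (t := F))
      (√(E.card * ρ) / 2) (k * (√(m * ρ) / 2)) (64 * (E.card * ρ)) (64 * ((F \ E).card * ρ))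
    rw [Finset.union_sdiff_of_subset hEF] at hmul
    rw [pow_succ']
    refine ((mul_le_mul' hfirst hrest).trans hmul).trans (measure_mono (tailEvent_mono ?_ ?_))
    · rw [hE]; push_cast; linarith
    · rw [hsdiff]; push_cast; linarith

end SignWords

section DecisionTree

open ProbabilityTheory

variable {ι : Type*} [Fintype ι] {ρ : unitInterval}

theorem le_signWordLaw_le_abs_add_signSum {F : Finset ι} {t w : ℝ} {β : ℝ≥0∞}
    (hβ : β ≤ signWordLaw ι ρ (tailEvent F t w)) (b : ℝ) :
    β ≤ signWordLaw ι ρ {u | t ≤ |b + signSum F u| ∧ signWeight F u ≤ w} := by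
  rcases le_total 0 b with hb | hb
  · refine hβ.trans (measure_mono fun u hu => ⟨?_, hu.2⟩)
    exact hu.1.trans ((le_add_of_nonneg_left hb).trans (le_abs_self _))
  · rw [← (measurePreserving_neg_signWordLaw ρ).measure_preimage
      MeasurableSet.of_discrete.nullMeasurableSet] at hβ
    refine hβ.trans (measure_mono fun u hu => ⟨?_, signWeight_neg F u ▸ hu.2⟩)
    have hu : t ≤ -signSum F u := signSum_neg F u ▸ hu.1
    exact le_trans (by linarith) (neg_le_abs _)

variable [DecidableEq ι]

theorem signSum_piecewise (F : Finset ι) (s u : ι → SignType) :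
    signSum Finset.univ (F.piecewise s u) = signSum F s + signSum Fᶜ u := by
  rw [signSum, ← Finset.sum_add_sum_compl F]
  congr 1 <;> exact Finset.sum_congr rfl fun i hi => by simp_all

theorem signWeight_piecewise (F : Finset ι) (s u : ι → SignType) :
    signWeight Finset.univ (F.piecewise s u) = signWeight F s + signWeight Fᶜ u := by
  rw [signWeight, ← Finset.sum_add_sum_compl F]
  congr 1 <;> exact Finset.sum_congr rfl fun i hi => by simp_all

theorem IsAdaptive.half_le_signWordLaw_error {I : (ι → SignType) → Finset ι} (hI : IsAdaptive I)
    {out : (ι → SignType) → ℝ} (hout : ∀ s s', (∀ i ∈ I s, s' i = s i) → out s' = out s)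
    {t w : ℝ} {β : ℝ≥0∞} (hβ : ∀ s, β ≤ signWordLaw ι ρ (tailEvent (I s)ᶜ t w))
    (hw : 2⁻¹ ≤ signWordLaw ι ρ {s | signWeight Finset.univ s ≤ w}) :
    β / 2 ≤ signWordLaw ι ρ
      {s | t ≤ |out s - signSum Finset.univ s| ∧ signWeight Finset.univ s ≤ 2 * w} := by
  set P := signWordLaw ι ρ
  set E := {s | t ≤ |out s - signSum Finset.univ s| ∧ signWeight Finset.univ s ≤ 2 * w}
  have hresample : MeasurePreserving (fun z => (I z.1).piecewise z.1 z.2) (P.prod P) P :=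
    hI.measurePreserving_resample _
  have hfiber (s : ι → SignType) (hs : signWeight Finset.univ s ≤ w) :
      β ≤ P ((fun u => (I s).piecewise s u) ⁻¹' E) := by
    refine (le_signWordLaw_le_abs_add_signSum (hβ s) (signSum (I s) s - out s)).trans
      (measure_mono fun u ⟨hu, huw⟩ => ?_)
    simp only [E, mem_preimage, mem_ofPred_eq, signSum_piecewise, signWeight_piecewise]
    have hseen : signWeight (I s) s ≤ signWeight Finset.univ s :=
      Finset.sum_le_univ_sum_of_nonneg fun i => abs_nonneg _
    rw [hout s _ fun _ hi => Finset.piecewise_eq_of_mem _ _ _ hi, abs_sub_comm, add_sub_right_comm]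
    exact ⟨hu, by linarith⟩
  calc β / 2 ≤ β * P {s | signWeight Finset.univ s ≤ w} := by
        rw [div_eq_mul_inv]; gcongr
    _ = ∫⁻ _ in {s | signWeight Finset.univ s ≤ w}, β ∂P := (setLIntegral_const _ _).symm
    _ ≤ ∫⁻ s in {s | signWeight Finset.univ s ≤ w}, P ((fun u => (I s).piecewise s u) ⁻¹' E) ∂P :=
        setLIntegral_mono .of_discrete hfiber
    _ ≤ ∫⁻ s, P ((fun u => (I s).piecewise s u) ⁻¹' E) ∂P := setLIntegral_le_lintegral _ _
    _ = P E := by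
        rw [← hresample.measure_preimage (s := E) MeasurableSet.of_discrete.nullMeasurableSet,
          Measure.prod_apply .of_discrete]
        rfl

end DecisionTree

section Algorithms

variable {d : ℕ} {G : Set (Fin d → ℝ)} {n : ℕ} {Ω : Type*} (A : MCAlgorithm G n Ω) (ω : Ω)

/-- The `k`-th point at which the algorithm evaluates `f`. -/
def MCAlgorithm.point (f : (Fin d → ℝ) → ℝ) (k : ℕ) : Fin d → ℝ :=
  A.node ω k (A.info ω f k)

theorem MCAlgorithm.info_congr {f f' : (Fin d → ℝ) → ℝ}
    (h : ∀ k < n, f' (A.point ω f k) = f (A.point ω f k)) {k : ℕ} (hk : k ≤ n) :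
    A.info ω f' k = A.info ω f k := by
  induction k with
  | zero => rfl
  | succ k ih =>
    have hvalue := h k hk
    rw [MCAlgorithm.point] at hvalue
    simp only [MCAlgorithm.info, ih (Nat.le_of_succ_le hk), hvalue]

variable {ι α : Type*} [DecidableEq ι] (f : (ι → α) → (Fin d → ℝ) → ℝ) (J : (Fin d → ℝ) → ι)

/-- The places of the word `s` that the algorithm sees on the input `f s`, when a function value at
`x` depends on the letter at the place `J x` only. -/
def MCAlgorithm.observed (s : ι → α) : Finset ι :=
  (Finset.range n).image fun k => J (A.point ω (f s) k)

theorem MCAlgorithm.card_observed_le (s : ι → α) : (A.observed ω f J s).card ≤ n :=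
  Finset.card_image_le.trans_eq (Finset.card_range n)

variable {f J} {s s' : ι → α}

theorem MCAlgorithm.info_eq_of_eq_on_observed
    (hf : ∀ x s s', s' (J x) = s (J x) → f s' x = f s x)
    (h : ∀ i ∈ A.observed ω f J s, s' i = s i) {k : ℕ} (hk : k ≤ n) :
    A.info ω (f s') k = A.info ω (f s) k :=
  A.info_congr ω
    (fun _ hj => hf _ _ _ (h _ (Finset.mem_image_of_mem _ (Finset.mem_range.2 hj)))) hk

theorem MCAlgorithm.run_eq_of_eq_on_observed
    (hf : ∀ x s s', s' (J x) = s (J x) → f s' x = f s x)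
    (h : ∀ i ∈ A.observed ω f J s, s' i = s i) : A.run ω (f s') = A.run ω (f s) :=
  congrArg (A.output ω) (A.info_eq_of_eq_on_observed ω hf h le_rfl)

theorem MCAlgorithm.isAdaptive_observed
    (hf : ∀ x s s', s' (J x) = s (J x) → f s' x = f s x) : IsAdaptive (A.observed ω f J) := by
  refine fun s s' h => Finset.image_congr fun k hk => ?_
  simp only [MCAlgorithm.point,
    A.info_eq_of_eq_on_observed ω hf h (Finset.mem_range.1 (Finset.mem_coe.1 hk)).le]

end Algorithms

section Fooling

theorem le_of_forall_le_measure_section {S Ω : Type*} [MeasurableSpace S] [MeasurableSpace Ω]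
    [Countable S] [MeasurableSingletonClass S] {ν : Measure S} {P : Measure Ω}
    [IsProbabilityMeasure ν] [IsProbabilityMeasure P] {E : Set (S × Ω)}
    (hE : ∀ s, MeasurableSet (Prod.mk s ⁻¹' E)) {η δ : ℝ≥0∞}
    (hη : ∀ ω, η ≤ ν {s | (s, ω) ∈ E}) (hδ : ∀ s, P {ω | (s, ω) ∈ E} ≤ δ) : η ≤ δ := by
  have hEm : MeasurableSet E := by
    rw [show E = ⋃ s, {s} ×ˢ (Prod.mk s ⁻¹' E) by ext ⟨s, ω⟩; simp]
    exact .iUnion fun s => (measurableSet_singleton s).prod (hE s)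
  calc η = ∫⁻ _, η ∂P := by simp
    _ ≤ ∫⁻ ω, ν {s | (s, ω) ∈ E} ∂P := lintegral_mono hη
    _ = ∫⁻ s, P {ω | (s, ω) ∈ E} ∂ν :=
        (Measure.prod_apply_symm hEm).symm.trans (Measure.prod_apply hEm)
    _ ≤ ∫⁻ _, δ ∂ν := lintegral_mono hδ
    _ = δ := by simp

theorem probError_mono_space {d : ℕ} (G : Set (Fin d → ℝ)) (n : ℕ) (δ : ℝ)
    {𝓥 𝓦 : Set ((Fin d → ℝ) → ℝ)} (h : 𝓥 ⊆ 𝓦) (norm : ((Fin d → ℝ) → ℝ) → ℝ≥0∞) :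
    probError.{u} G n δ 𝓥 norm ≤ probError.{u} G n δ 𝓦 norm := by
  refine sInf_le_sInf ?_
  rintro _ ⟨ε, hε, rfl, Ω, i, P, hP, A, hmeas, happ⟩
  exact ⟨ε, hε, rfl, Ω, i, P, hP, A, fun f hf => hmeas f (h hf), fun f hf => happ f (h hf)⟩

variable {d : ℕ} {G : Set (Fin d → ℝ)} {n : ℕ} {δ : ℝ} {𝓦 : Set ((Fin d → ℝ) → ℝ)}
  {norm : ((Fin d → ℝ) → ℝ) → ℝ≥0∞} {ι : Type*} [Fintype ι] {ρ : unitInterval}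
  {f : (ι → SignType) → (Fin d → ℝ) → ℝ} {J : (Fin d → ℝ) → ι} {κ : ℝ}

theorem ofReal_mul_le_probError {t w : ℝ} {β : ℝ≥0∞} (hδ : ENNReal.ofReal δ < β / 2)
    (hw : 2⁻¹ ≤ signWordLaw ι ρ {s | signWeight Finset.univ s ≤ w})
    (hβ : ∀ F : Finset ι, Fintype.card ι ≤ F.card + n → β ≤ signWordLaw ι ρ (tailEvent F t w))
    (hκ : 0 < κ) (hlocal : ∀ x s s', s' (J x) = s (J x) → f s' x = f s x)
    (hf : ∀ s, signWeight Finset.univ s ≤ 2 * w → f s ∈ 𝓦 ∧ norm (f s) ≤ 1 ∧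
      ∫ x in G, f s x = κ * signSum Finset.univ s) :
    ENNReal.ofReal (κ * t) ≤ probError.{u} G n δ 𝓦 norm := by
  classical
  refine le_sInf ?_
  rintro _ ⟨ε, _, rfl, Ω, _, P, _, A, hmeas, happ⟩
  refine ENNReal.ofReal_le_ofReal (not_lt.1 fun hlt => hδ.not_ge ?_)
  let E : Set ((ι → SignType) × Ω) :=
    {z | signWeight Finset.univ z.1 ≤ 2 * w ∧ ε < A.error (f z.1) z.2}
  refine le_of_forall_le_measure_section (ν := signWordLaw ι ρ) (P := P) (E := E)
    (fun s => ?_) (fun ω => ?_) fun s => ?_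
  · by_cases hs : signWeight Finset.univ s ≤ 2 * w
    · simpa [E, hs] using measurableSet_lt measurable_const (hmeas _ (hf s hs).1)
    · simp [E, hs]
  · refine ((A.isAdaptive_observed ω hlocal).half_le_signWordLaw_error
      (out := fun s => A.run ω (f s) / κ) (t := t)
      (fun s s' h => by rw [A.run_eq_of_eq_on_observed ω hlocal h])
      (fun s => hβ _ ?_) hw).trans (measure_mono fun s hs => ⟨hs.2, ?_⟩)
    · have := A.card_observed_le ω f J s
      rw [Finset.card_compl]
      omega
    · rw [MCAlgorithm.error, (hf s hs.2).2.2, ← mul_div_cancel₀ (A.run ω (f s)) hκ.ne', ← mul_sub,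
        abs_mul, abs_of_pos hκ]
      exact hlt.trans_le (mul_le_mul_of_nonneg_left hs.1 hκ.le)
  · by_cases hs : signWeight Finset.univ s ≤ 2 * w
    · simpa [E, hs] using happ _ (hf s hs).1 (hf s hs).2.1
    · simp [E, hs]

theorem ofReal_mul_le_probError_of_blocks (hι : Fintype.card ι = 2 * n) {k m : ℕ} (hk : 1 ≤ k)
    (hkm : k * m ≤ n) (hm : 1 ≤ m * (ρ : ℝ)) (hδ : δ < 32⁻¹ ^ k / 2)
    (hκ : 0 < κ) (hlocal : ∀ x s s', s' (J x) = s (J x) → f s' x = f s x)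
    (hf : ∀ s, signWeight Finset.univ s ≤ 256 * (n * ρ) → f s ∈ 𝓦 ∧ norm (f s) ≤ 1 ∧
      ∫ x in G, f s x = κ * signSum Finset.univ s) :
    ENNReal.ofReal (κ * (k * (√(m * ρ) / 2))) ≤ probError.{u} G n δ 𝓦 norm := by
  have hnρ : 0 < n * (ρ : ℝ) := by
    have hmn : m ≤ n := (Nat.le_mul_of_pos_left m hk).trans hkm
    have := ρ.2.1
    exact zero_lt_one.trans_le (hm.trans (by gcongr))
  have hδ' : ENNReal.ofReal δ < 32⁻¹ ^ k / 2 := by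
    rw [← ENNReal.ofReal_lt_ofReal_iff (by positivity)] at hδ
    simpa [ENNReal.ofReal_div_of_pos, ENNReal.ofReal_inv_of_pos, ENNReal.inv_pow] using hδ
  refine ofReal_mul_le_probError (ρ := ρ) (w := 128 * (n * ρ)) hδ'
    (half_le_signWordLaw_signWeight_le Finset.univ ρ (by linarith) ?_) (fun F hF => ?_) hκ
    hlocal fun s hs => hf s (by linarith)
  · rw [Finset.card_univ, hι]
    push_cast
    linarith
  · refine (pow_le_signWordLaw_tailEvent hm hk (hkm.trans (by omega))).trans
      (measure_mono (tailEvent_mono le_rfl ?_))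
    have hFn : (F.card : ℝ) ≤ 2 * n := mod_cast (Finset.card_le_univ F).trans_eq hι
    have := mul_le_mul_of_nonneg_right hFn ρ.2.1
    linarith

end Fooling

section PartialDerivatives

variable {d : ℕ} {f φ : (Fin d → ℝ) → ℝ}

/-- The classical derivative `∂_{i_1} ⋯ ∂_{i_k} φ` along the word `l = [i_1, …, i_k]`. -/
noncomputable def iteratedPartialD (l : List (Fin d)) (φ : (Fin d → ℝ) → ℝ) : (Fin d → ℝ) → ℝ :=
  l.foldr partialD φ

/-- The word `1 ⋯ 1 2 ⋯ 2 ⋯ d ⋯ d` with `α i` letters `i`, along which `D^α` differentiates. -/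
def multiWord (α : Fin d → ℕ) : List (Fin d) :=
  (List.finRange d).flatMap fun i => List.replicate (α i) i

theorem multiD_eq_iteratedPartialD (α : Fin d → ℕ) (φ : (Fin d → ℝ) → ℝ) :
    multiD α φ = iteratedPartialD (multiWord α) φ := by
  have hreplicate (k : ℕ) (i : Fin d) (ψ : (Fin d → ℝ) → ℝ) :
      (List.replicate k i).foldr partialD ψ = (partialD i)^[k] ψ := by
    induction k with
    | zero => rfl
    | succ k ih => rw [List.replicate_succ, List.foldr_cons, ih, Function.iterate_succ_apply']
  simp only [multiD, iteratedPartialD, multiWord, List.foldr_flatMap, hreplicate]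

theorem length_multiWord (α : Fin d → ℕ) : (multiWord α).length = ∑ i, α i := by
  simp [multiWord, List.length_flatMap, Fin.sum_univ_def]

theorem contDiff_partialD (hφ : ContDiff ℝ (⊤ : ℕ∞) φ) (i : Fin d) :
    ContDiff ℝ (⊤ : ℕ∞) (partialD i φ) :=
  (hφ.fderiv_right le_rfl).clm_apply contDiff_const

theorem contDiff_iteratedPartialD (hφ : ContDiff ℝ (⊤ : ℕ∞) φ) (l : List (Fin d)) :
    ContDiff ℝ (⊤ : ℕ∞) (iteratedPartialD l φ) := by
  induction l with
  | nil => exact hφ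
  | cons i l ih => exact contDiff_partialD ih i

theorem tsupport_iteratedPartialD_subset (l : List (Fin d)) (φ : (Fin d → ℝ) → ℝ) :
    tsupport (iteratedPartialD l φ) ⊆ tsupport φ := by
  induction l with
  | nil => exact Subset.rfl
  | cons i l ih => exact (tsupport_fderiv_apply_subset ℝ _).trans ih

theorem hasCompactSupport_iteratedPartialD (hφ : HasCompactSupport φ) (l : List (Fin d)) :
    HasCompactSupport (iteratedPartialD l φ) :=
  hφ.of_isClosed_subset (isClosed_tsupport _) (tsupport_iteratedPartialD_subset l φ)

theorem integral_mul_partialD_eq_neg (hf : ContDiff ℝ (⊤ : ℕ∞) f) (hφ : ContDiff ℝ (⊤ : ℕ∞) φ)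
    (hc : HasCompactSupport φ) (i : Fin d) :
    ∫ x, f x * partialD i φ x = -∫ x, partialD i f x * φ x := by
  have hint {u v : (Fin d → ℝ) → ℝ} (hu : ContDiff ℝ (⊤ : ℕ∞) u) (hv : ContDiff ℝ (⊤ : ℕ∞) v)
      (hv0 : HasCompactSupport v) : Integrable fun x => u x * v x :=
    (hu.continuous.mul hv.continuous).integrable_of_hasCompactSupport hv0.mul_left
  exact integral_mul_fderiv_eq_neg_fderiv_mul_of_integrable (hint (contDiff_partialD hf i) hφ hc)
    (hint hf (contDiff_partialD hφ i) (hasCompactSupport_iteratedPartialD hc [i])) (hint hf hφ hc)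
    (fun x _ => hf.differentiable (by simp) x) (fun x _ => hφ.differentiable (by simp) x)

theorem integral_mul_iteratedPartialD (hf : ContDiff ℝ (⊤ : ℕ∞) f) (hφ : ContDiff ℝ (⊤ : ℕ∞) φ)
    (hc : HasCompactSupport φ) (l : List (Fin d)) :
    ∫ x, f x * iteratedPartialD l φ x =
      (-1) ^ l.length * ∫ x, iteratedPartialD l.reverse f x * φ x := by
  induction l generalizing f with
  | nil => simp [iteratedPartialD]
  | cons i l ih =>
    have hstep := integral_mul_partialD_eq_neg hf (contDiff_iteratedPartialD hφ l)
      (hasCompactSupport_iteratedPartialD hc l) i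
    have hrev :
        iteratedPartialD (i :: l).reverse f = iteratedPartialD l.reverse (partialD i f) := by
      simp [iteratedPartialD]
    rw [hrev, List.length_cons, pow_succ', mul_assoc, ← ih (contDiff_partialD hf i), neg_one_mul]
    exact hstep

theorem isWeakDeriv_iteratedPartialD (hf : ContDiff ℝ (⊤ : ℕ∞) f) (U : Set (Fin d → ℝ))
    (α : Fin d → ℕ) : IsWeakDeriv U α f (iteratedPartialD (multiWord α).reverse f) := by
  refine ⟨hf.continuous.locallyIntegrable.locallyIntegrableOn U,
    (contDiff_iteratedPartialD hf _).continuous.locallyIntegrable.locallyIntegrableOn U,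
    fun φ hφ hc hU => ?_⟩
  have hglobal {u v : (Fin d → ℝ) → ℝ} (hv : tsupport v ⊆ tsupport φ) :
      ∫ x in U, u x * v x = ∫ x, u x * v x :=
    setIntegral_eq_integral_of_forall_compl_eq_zero fun x hx => by
      rw [image_eq_zero_of_notMem_tsupport fun h => hx (hU (hv h)), mul_zero]
  rw [multiD_eq_iteratedPartialD, hglobal (tsupport_iteratedPartialD_subset _ φ),
    hglobal Subset.rfl, integral_mul_iteratedPartialD hf hφ hc, length_multiWord]

end PartialDerivatives

section SobolevNorm

theorem lpSum_le_card_mul {ι : Type*} {p : ℝ≥0∞} (hp : 1 ≤ p) {s : Finset ι} {v : ι → ℝ≥0∞}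
    {x : ℝ≥0∞} (hs : s.Nonempty) (h : ∀ a ∈ s, v a ≤ x) : lpSum p s v ≤ s.card * x := by
  have hcard : (1 : ℝ≥0∞) ≤ s.card := by exact_mod_cast hs.card_pos
  rw [lpSum]
  split_ifs with hptop
  · exact (Finset.sup_le h).trans (le_mul_of_one_le_left' hcard)
  have hp1 : 1 ≤ p.toReal := by simpa using ENNReal.toReal_mono hptop hp
  have hp0 : 0 < p.toReal := one_pos.trans_le hp1
  calc (∑ a ∈ s, v a ^ p.toReal) ^ (1 / p.toReal)
      ≤ (∑ _a ∈ s, x ^ p.toReal) ^ (1 / p.toReal) := by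
        gcongr with a ha
        exact h a ha
    _ = (s.card : ℝ≥0∞) ^ (1 / p.toReal) * x := by
        rw [Finset.sum_const, nsmul_eq_mul, ENNReal.mul_rpow_of_nonneg _ _ (by positivity),
          ← ENNReal.rpow_mul, mul_one_div_cancel hp0.ne', ENNReal.rpow_one]
    _ ≤ s.card * x := by
        gcongr
        simpa using ENNReal.rpow_le_rpow_of_exponent_le hcard ((div_le_one hp0).2 hp1)

variable {d r : ℕ} {p : ℝ≥0∞} {f : (Fin d → ℝ) → ℝ}

theorem sobolevNorm_le (hp : 1 ≤ p) (G : Set (Fin d → ℝ)) (hf : ContDiff ℝ (⊤ : ℕ∞) f) {B : ℝ}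
    (hB : ∀ w : List (Fin d), w.length ≤ r → ∀ x, |iteratedPartialD w f x| ≤ B) :
    sobolevNorm r p G f ≤ (multiIndices d r).card *
      (ENNReal.ofReal B * volume (tsupport f) ^ (1 / p.toReal)) := by
  have hB0 : 0 ≤ B := (abs_nonneg _).trans (hB [] (Nat.zero_le r) 0)
  have h0 : iteratedPartialD (multiWord 0).reverse f = f := by
    rw [List.eq_nil_of_length_eq_zero (l := multiWord 0) (by simp [length_multiWord])]
    rfl
  refine (iInf₂_le (fun α => iteratedPartialD (multiWord α).reverse f)
    ⟨h0, fun α _ _ => isWeakDeriv_iteratedPartialD hf _ α⟩).trans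
    (lpSum_le_card_mul hp ⟨0, mem_multiIndices.2 (by simp)⟩ fun α hα => ?_)
  set w := (multiWord α).reverse
  have hw : w.length ≤ r := by
    rw [List.length_reverse, length_multiWord]
    exact mem_multiIndices.1 hα
  calc eLpNorm (iteratedPartialD w f) p _
      ≤ eLpNorm (iteratedPartialD w f) p volume := eLpNorm_mono_measure _ Measure.restrict_le_self
    _ ≤ eLpNorm ((tsupport f).indicator fun _ => B) p volume := by
        refine eLpNorm_mono fun x => ?_
        by_cases hx : x ∈ tsupport f
        · rw [indicator_of_mem hx, Real.norm_of_nonneg hB0]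
          exact hB w hw x
        · rw [image_eq_zero_of_notMem_tsupport
            fun h => hx (tsupport_iteratedPartialD_subset w f h), norm_zero]
          exact norm_nonneg _
    _ ≤ ‖B‖ₑ * volume (tsupport f) ^ (1 / p.toReal) := eLpNorm_indicator_const_le B p
    _ = _ := by rw [Real.enorm_of_nonneg hB0]

theorem mem_continuousSobolevSpace (G : Set (Fin d → ℝ)) (hf : ContDiff ℝ (⊤ : ℕ∞) f)
    (hc : HasCompactSupport f) (hnorm : sobolevNorm r p G f < ⊤) :
    f ∈ continuousSobolevSpace r p G :=
  ⟨⟨(hf.continuous.memLp_of_hasCompactSupport hc).restrict G, hnorm,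
    (hf.continuous.integrable_of_hasCompactSupport hc).integrableOn⟩, hf.continuous.continuousOn⟩

end SobolevNorm

section Bumps

/-- The superposition `∑ᵢ vᵢ b((x - cᵢ) / h)` of copies of the bump `b`, shrunk by the factor `h`
and moved to the centers `cᵢ`. -/
noncomputable def bumpSum {d : ℕ} {ι : Type*} [Fintype ι] (b : (Fin d → ℝ) → ℝ) (h : ℝ)
    (c : ι → Fin d → ℝ) (v : ι → ℝ) (x : Fin d → ℝ) : ℝ :=
  ∑ i, v i * b (h⁻¹ • (x - c i))

variable {d : ℕ} {ι : Type*} [Fintype ι] {b : (Fin d → ℝ) → ℝ} {h : ℝ} {c : ι → Fin d → ℝ}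

theorem contDiff_bumpSum (hb : ContDiff ℝ (⊤ : ℕ∞) b) (h : ℝ) (c : ι → Fin d → ℝ) (v : ι → ℝ) :
    ContDiff ℝ (⊤ : ℕ∞) (bumpSum b h c v) :=
  ContDiff.sum fun _ _ => contDiff_const.mul
    (hb.comp ((contDiff_id.sub contDiff_const).const_smul h⁻¹))

theorem partialD_bumpSum (hb : ContDiff ℝ (⊤ : ℕ∞) b) (h : ℝ) (c : ι → Fin d → ℝ) (v : ι → ℝ)
    (j : Fin d) : partialD j (bumpSum b h c v) = bumpSum (partialD j b) h c (h⁻¹ • v) := by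
  funext x
  have hterm (i : ι) : HasFDerivAt (fun x => v i * b (h⁻¹ • (x - c i)))
      (v i • (fderiv ℝ b (h⁻¹ • (x - c i))).comp (h⁻¹ • ContinuousLinearMap.id ℝ (Fin d → ℝ))) x :=
    ((hb.differentiable (by simp) _).hasFDerivAt.comp x
      (((hasFDerivAt_id x).sub_const (c i)).const_smul h⁻¹)).const_mul (v i)
  have hsum : HasFDerivAt (bumpSum b h c v) _ x := HasFDerivAt.fun_sum fun i _ => hterm i
  simp only [partialD, hsum.fderiv, bumpSum, sum_apply, smul_apply,
    ContinuousLinearMap.comp_apply, ContinuousLinearMap.id_apply,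
    map_smul, smul_eq_mul, Pi.smul_apply]
  exact Finset.sum_congr rfl fun i _ => by ring

theorem iteratedPartialD_bumpSum (hb : ContDiff ℝ (⊤ : ℕ∞) b) (h : ℝ) (c : ι → Fin d → ℝ)
    (v : ι → ℝ) (w : List (Fin d)) :
    iteratedPartialD w (bumpSum b h c v) =
      bumpSum (iteratedPartialD w b) h c (h⁻¹ ^ w.length • v) := by
  induction w with
  | nil => simp [iteratedPartialD]
  | cons j w ih =>
    change partialD j (iteratedPartialD w _) = _
    rw [ih, partialD_bumpSum (contDiff_iteratedPartialD hb w), smul_smul, ← pow_succ']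
    rfl

theorem apply_inv_smul_sub_eq_zero (hh : 0 < h) (hb : tsupport b ⊆ Metric.closedBall 0 1)
    {x y : Fin d → ℝ} (hx : x ∉ Metric.closedBall y h) : b (h⁻¹ • (x - y)) = 0 := by
  refine image_eq_zero_of_notMem_tsupport fun hmem => hx ?_
  have hnorm := mem_closedBall_zero_iff.1 (hb hmem)
  rwa [norm_smul, norm_inv, Real.norm_of_nonneg hh.le, inv_mul_le_one₀ hh,
    ← mem_closedBall_iff_norm] at hnorm

theorem tsupport_bumpSum_subset (hh : 0 < h) (hb : tsupport b ⊆ Metric.closedBall 0 1)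
    (c : ι → Fin d → ℝ) (v : ι → ℝ) :
    tsupport (bumpSum b h c v) ⊆ ⋃ i ∈ Finset.univ.filter (v · ≠ 0), Metric.closedBall (c i) h := by
  refine closure_minimal (fun x hx => ?_)
    (isClosed_biUnion_finset fun _ _ => Metric.isClosed_closedBall)
  obtain ⟨i, -, hi⟩ := Finset.exists_ne_zero_of_sum_ne_zero hx
  exact mem_iUnion₂.2 ⟨i, by simpa using left_ne_zero_of_mul hi,
    by_contra fun hxi => right_ne_zero_of_mul hi (apply_inv_smul_sub_eq_zero hh hb hxi)⟩

theorem hasCompactSupport_bumpSum (hh : 0 < h) (hb : tsupport b ⊆ Metric.closedBall 0 1)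
    (c : ι → Fin d → ℝ) (v : ι → ℝ) : HasCompactSupport (bumpSum b h c v) :=
  (Finset.isCompact_biUnion _ fun i _ => isCompact_closedBall (c i) h).of_isClosed_subset
    (isClosed_tsupport _) (tsupport_bumpSum_subset hh hb c v)

theorem volume_tsupport_bumpSum_le (hh : 0 < h) (hb : tsupport b ⊆ Metric.closedBall 0 1)
    (c : ι → Fin d → ℝ) (v : ι → ℝ) :
    volume (tsupport (bumpSum b h c v)) ≤
      ENNReal.ofReal ((Finset.univ.filter (v · ≠ 0)).card * (2 * h) ^ d) := by
  refine (measure_mono (tsupport_bumpSum_subset hh hb c v)).trans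
    ((measure_biUnion_finset_le _ _).trans_eq ?_)
  simp only [Real.volume_pi_closedBall _ hh.le, Finset.sum_const, nsmul_eq_mul, Fintype.card_fin]
  rw [ENNReal.ofReal_mul (Nat.cast_nonneg _), ENNReal.ofReal_natCast]

theorem exists_bumpSum_eq [Nonempty ι] (hh : 0 < h) (hb : tsupport b ⊆ Metric.closedBall 0 1)
    (hc : Pairwise fun i j => Disjoint (Metric.closedBall (c i) h) (Metric.closedBall (c j) h))
    (x : Fin d → ℝ) : ∃ i, ∀ v, bumpSum b h c v x = v i * b (h⁻¹ • (x - c i)) := by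
  obtain ⟨i, hi⟩ : ∃ i, ∀ j ≠ i, x ∉ Metric.closedBall (c j) h := by
    by_cases hx : ∃ i, x ∈ Metric.closedBall (c i) h
    · exact hx.imp fun i hi j hji hj => disjoint_left.1 (hc hji) hj hi
    · exact ⟨Classical.arbitrary ι, fun j _ hj => hx ⟨j, hj⟩⟩
  refine ⟨i, fun v => Finset.sum_eq_single_of_mem i (Finset.mem_univ i) fun j _ hji => ?_⟩
  rw [apply_inv_smul_sub_eq_zero hh hb (hi j hji), mul_zero]

theorem integral_bumpSum (hh : 0 < h) (hb : Continuous b) (hbc : HasCompactSupport b)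
    (c : ι → Fin d → ℝ) (v : ι → ℝ) :
    ∫ x, bumpSum b h c v x = h ^ d * (∫ x, b x) * ∑ i, v i := by
  have hcopy (i : ι) : ∫ x, b (h⁻¹ • (x - c i)) = h ^ d * ∫ x, b x := by
    rw [integral_sub_right_eq_self (fun x => b (h⁻¹ • x)), Measure.integral_comp_smul]
    simp [abs_of_pos hh]
  have hint (i : ι) : Integrable fun x => b (h⁻¹ • (x - c i)) :=
    ((hb.integrable_of_hasCompactSupport hbc).comp_smul (inv_ne_zero hh.ne')).comp_sub_right (c i)
  simp only [bumpSum]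
  rw [integral_finsetSum _ fun i _ => (hint i).const_mul _]
  simp only [integral_const_mul, hcopy, ← Finset.sum_mul]
  ring

theorem setIntegral_bumpSum (hh : 0 < h) (hb : Continuous b)
    (hb1 : tsupport b ⊆ Metric.closedBall 0 1) (v : ι → ℝ) {G : Set (Fin d → ℝ)}
    (hcG : ∀ i, Metric.closedBall (c i) h ⊆ G) :
    ∫ x in G, bumpSum b h c v x = h ^ d * (∫ x, b x) * ∑ i, v i := by
  have hsupp : tsupport (bumpSum b h c v) ⊆ G :=
    (tsupport_bumpSum_subset hh hb1 c v).trans (iUnion₂_subset fun i _ => hcG i)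
  rw [setIntegral_eq_integral_of_forall_compl_eq_zero fun x hx =>
      image_eq_zero_of_notMem_tsupport fun hmem => hx (hsupp hmem)]
  exact integral_bumpSum hh hb
    ((isCompact_closedBall 0 1).of_isClosed_subset (isClosed_tsupport b) hb1) c v

theorem abs_iteratedPartialD_bumpSum_le [Nonempty ι] (hh : 0 < h) (hh1 : h ≤ 1)
    (hb : ContDiff ℝ (⊤ : ℕ∞) b) (hb1 : tsupport b ⊆ Metric.closedBall 0 1)
    (hc : Pairwise fun i j => Disjoint (Metric.closedBall (c i) h) (Metric.closedBall (c j) h))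
    {r : ℕ} {C K : ℝ} (hC : ∀ w : List (Fin d), w.length ≤ r → ∀ x, |iteratedPartialD w b x| ≤ C)
    {v : ι → ℝ} (hv : ∀ i, |v i| ≤ K) {w : List (Fin d)} (hw : w.length ≤ r) (x : Fin d → ℝ) :
    |iteratedPartialD w (bumpSum b h c v) x| ≤ h⁻¹ ^ r * K * C := by
  obtain ⟨i, hi⟩ := exists_bumpSum_eq hh ((tsupport_iteratedPartialD_subset w b).trans hb1) hc x
  have hpow : h⁻¹ ^ w.length ≤ h⁻¹ ^ r := pow_le_pow_right₀ (one_le_inv₀ hh |>.2 hh1) hw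
  have hK : 0 ≤ K := (abs_nonneg _).trans (hv i)
  rw [iteratedPartialD_bumpSum hb, hi, Pi.smul_apply, smul_eq_mul, abs_mul, abs_mul,
    abs_of_pos (show 0 < h⁻¹ ^ w.length by positivity)]
  exact mul_le_mul (mul_le_mul hpow (hv i) (abs_nonneg _) (by positivity)) (hC w hw _)
    (abs_nonneg _) (by positivity)

theorem exists_contDiff_bump (d r : ℕ) : ∃ (b : (Fin d → ℝ) → ℝ) (C : ℝ),
    ContDiff ℝ (⊤ : ℕ∞) b ∧ tsupport b ⊆ Metric.closedBall 0 1 ∧ 0 < ∫ x, b x ∧ 0 < C ∧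
      ∀ w : List (Fin d), w.length ≤ r → ∀ x, |iteratedPartialD w b x| ≤ C := by
  let b : ContDiffBump (0 : Fin d → ℝ) := ⟨1 / 2, 1, by norm_num, by norm_num⟩
  have hbound (w : List (Fin d)) : ∃ C, ∀ x, |iteratedPartialD w b x| ≤ C :=
    (contDiff_iteratedPartialD b.contDiff w).continuous.bounded_above_of_compact_support
      (hasCompactSupport_iteratedPartialD b.hasCompactSupport w)
  choose C hC using hbound
  obtain ⟨C', hC'⟩ := ((List.finite_length_le (Fin d) r).image C).bddAbove
  exact ⟨b, max C' 1, b.contDiff, b.tsupport_eq.subset, b.integral_pos, by positivity,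
    fun w hw x => (hC w x).trans ((hC' ⟨w, hw, rfl⟩).trans (le_max_left _ _))⟩

end Bumps

section Packing

variable {d : ℕ} {U : Set (Fin d → ℝ)}

theorem exists_disjoint_closedBall_subset_closedBall (x₀ : Fin d → ℝ) {t : ℝ} (ht : 0 < t)
    {N m : ℕ} (hm : N ≤ m ^ d) : ∃ c : Fin N → Fin d → ℝ,
      (Pairwise fun i j => Disjoint (Metric.closedBall (c i) t) (Metric.closedBall (c j) t)) ∧
      ∀ i, Metric.closedBall (c i) t ⊆ Metric.closedBall x₀ (3 * m * t) := by
  obtain ⟨e⟩ : Nonempty (Fin N ↪ (Fin d → Fin m)) :=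
    Function.Embedding.nonempty_of_card_le (by simpa using hm)
  refine ⟨fun i j => x₀ j + 3 * t * (e i j : ℕ), fun i i' hne => ?_, fun i => ?_⟩
  · obtain ⟨j, hj⟩ := Function.ne_iff.1 (e.injective.ne hne)
    have hgap : (1 : ℝ) ≤ |((e i j : ℕ) : ℝ) - (e i' j : ℕ)| := by
      have hne : (e i j : ℤ) - e i' j ≠ 0 := fun h => hj (Fin.ext (by omega))
      exact_mod_cast Int.one_le_abs hne
    refine Metric.closedBall_disjoint_closedBall
      (lt_of_lt_of_le ?_ (dist_le_pi_dist _ _ j))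
    rw [Real.dist_eq, add_sub_add_left_eq_sub, ← mul_sub, abs_mul, abs_of_pos (by positivity)]
    nlinarith
  · intro x hx
    rw [Metric.mem_closedBall, dist_pi_le_iff (by positivity)] at hx ⊢
    intro j
    have hcoord := abs_le.1 (hx j)
    have hlt : ((e i j : ℕ) : ℝ) + 1 ≤ m := by exact_mod_cast (e i j).2
    have hnonneg : 0 ≤ t * (e i j : ℕ) := by positivity
    rw [Real.dist_eq, abs_le]
    constructor <;> nlinarith

theorem exists_packing (hd : 1 ≤ d) (hU : IsOpen U) (hU' : U.Nonempty) :
    ∃ a : ℝ, 0 < a ∧ a ≤ 1 / 2 ∧ ∀ N : ℕ, 1 ≤ N → ∃ c : Fin N → Fin d → ℝ,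
      (Pairwise fun i j => Disjoint (Metric.closedBall (c i) (a * (N : ℝ) ^ (-(d : ℝ)⁻¹)))
        (Metric.closedBall (c j) (a * (N : ℝ) ^ (-(d : ℝ)⁻¹)))) ∧
      ∀ i, Metric.closedBall (c i) (a * (N : ℝ) ^ (-(d : ℝ)⁻¹)) ⊆ U := by
  obtain ⟨x₀, hx₀⟩ := hU'
  obtain ⟨ε, hε, hball⟩ := Metric.nhds_basis_closedBall.mem_iff.1 (hU.mem_nhds hx₀)
  refine ⟨min (ε / 6) (1 / 2), by positivity, min_le_right _ _, fun N hN => ?_⟩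
  have hN1 : (1 : ℝ) ≤ N := by exact_mod_cast hN
  set y : ℝ := (N : ℝ) ^ (d : ℝ)⁻¹ with hy
  have hy1 : 1 ≤ y := Real.one_le_rpow hN1 (by positivity)
  have hyd : y ^ d = N := Real.rpow_inv_natCast_pow (by positivity) (by omega)
  rw [Real.rpow_neg (by positivity), ← hy]
  have hm : N ≤ ⌈y⌉₊ ^ d := by
    have hpow := pow_le_pow_left₀ (by positivity) (Nat.le_ceil y) d
    rw [hyd] at hpow
    exact_mod_cast hpow
  obtain ⟨c, hdisj, hsub⟩ := exists_disjoint_closedBall_subset_closedBall x₀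
    (show 0 < min (ε / 6) (1 / 2) * y⁻¹ by positivity) hm
  refine ⟨c, hdisj, fun i => ((hsub i).trans (Metric.closedBall_subset_closedBall ?_)).trans hball⟩
  have hceil : (⌈y⌉₊ : ℝ) ≤ 2 * y := by linarith [Nat.ceil_lt_add_one (by positivity : 0 ≤ y)]
  calc 3 * ⌈y⌉₊ * (min (ε / 6) (1 / 2) * y⁻¹) ≤ 3 * (2 * y) * (ε / 6 * y⁻¹) := by
        gcongr
        exact min_le_left _ _
    _ = ε := by field_simp; norm_num

end Packing

section Rate

variable {d r n k : ℕ} {p : ℝ≥0∞} {δ : ℝ}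

theorem one_div_toReal_mem_Icc (hp : 1 ≤ p) : 1 / p.toReal ∈ Icc (0 : ℝ) 1 := by
  refine ⟨by positivity, ?_⟩
  rcases eq_or_ne p ⊤ with rfl | hptop
  · simp
  · have hp1 : 1 ≤ p.toReal := by simpa using ENNReal.toReal_mono hptop hp
    exact (div_le_one (one_pos.trans_le hp1)).2 hp1

theorem mul_rpow_le_mul_rpow {x y s : ℝ} (hx : 1 ≤ x) (hy : 0 ≤ y) (hs : s ∈ Icc (0 : ℝ) 1) :
    (x * y) ^ s ≤ x * y ^ s := by
  rw [Real.mul_rpow (by positivity) hy]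
  gcongr
  exact Real.rpow_le_self_of_one_le hx hs.2

theorem lowerRate_le (hp : 1 ≤ p) (hn : 1 ≤ n) (hδ : 0 < δ) (hδ1 : δ ≤ 1)
    (hk : k = n ∨ Real.log δ⁻¹ ≤ 12 * k) :
    lowerRate d r p n δ ≤ 12 * ((n : ℝ) ^ (-((r : ℝ) / d)) *
      ((k : ℝ) / n) ^ (1 - 1 / (min p 2).toReal)) := by
  have hn0 : (0 : ℝ) < n := by exact_mod_cast hn
  have hL : 0 ≤ Real.log δ⁻¹ := Real.log_nonneg ((one_le_inv₀ hδ).2 hδ1)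
  obtain ⟨hq0, hq1⟩ := one_div_toReal_mem_Icc (le_min hp one_le_two)
  simp only [lowerRate]
  set e := 1 / (min p 2).toReal
  have hX : 0 < (n : ℝ) ^ (-((r : ℝ) / d)) := by positivity
  rcases hk with rfl | hk
  · refine (min_le_left _ _).trans ?_
    rw [div_self hn0.ne', Real.one_rpow]
    linarith
  · have hlog : Real.log δ⁻¹ ^ (1 - e) ≤ 12 * (k : ℝ) ^ (1 - e) :=
      (Real.rpow_le_rpow hL hk (sub_nonneg.2 hq1)).trans
        (mul_rpow_le_mul_rpow (by norm_num) (Nat.cast_nonneg k)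
          ⟨sub_nonneg.2 hq1, sub_le_self 1 hq0⟩)
    refine (min_le_right _ _).trans ?_
    rw [show -((r : ℝ) / d + 1 - e) = -((r : ℝ) / d) - (1 - e) by ring, Real.rpow_sub hn0,
      Real.div_rpow (Nat.cast_nonneg k) hn0.le, div_mul_eq_mul_div, mul_div_assoc, mul_left_comm]
    rw [← mul_div_assoc 12]
    gcongr

theorem exists_block_count (hn : 1 ≤ n) (hδ : 0 < δ) (hδ₀ : δ < Real.exp (-6)) :
    ∃ k : ℕ, 1 ≤ k ∧ k ≤ n ∧ δ < 32⁻¹ ^ k / 2 ∧ (k = n ∨ Real.log δ⁻¹ ≤ 12 * k) := by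
  set L := Real.log δ⁻¹ with hL
  have hδL : δ = Real.exp (-L) := by rw [hL, Real.log_inv, neg_neg, Real.exp_log hδ]
  have hL6 : 6 < L := by
    rw [hδL, Real.exp_lt_exp] at hδ₀
    linarith
  have hfloor : 1 ≤ ⌊L / 6⌋₊ := Nat.le_floor (by push_cast; linarith)
  have hfloor_le : (⌊L / 6⌋₊ : ℝ) ≤ L / 6 := Nat.floor_le (by linarith)
  have hkn : (min n ⌊L / 6⌋₊ : ℕ) ≤ (⌊L / 6⌋₊ : ℝ) := by exact_mod_cast min_le_right _ _
  have hk1 : 1 ≤ min n ⌊L / 6⌋₊ := le_min hn hfloor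
  refine ⟨min n ⌊L / 6⌋₊, hk1, min_le_left _ _, ?_, ?_⟩
  · set k := min n ⌊L / 6⌋₊
    have hexp : Real.exp (-6) < 64⁻¹ := by
      have h2 : (2 : ℝ) < Real.exp 1 := by linarith [Real.exp_one_gt_d9]
      have h64 : (2 : ℝ) ^ 6 < Real.exp 1 ^ 6 := by gcongr
      rw [← Real.exp_nat_mul] at h64
      rw [Real.exp_neg]
      refine inv_strictAnti₀ (by norm_num) ?_
      norm_num at h64 ⊢
      exact h64
    calc δ ≤ Real.exp (-6) ^ k := by
          rw [hδL, ← Real.exp_nat_mul, Real.exp_le_exp]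
          linarith
      _ < 64⁻¹ ^ k := pow_lt_pow_left₀ hexp (Real.exp_pos _).le (by omega)
      _ = 32⁻¹ ^ k * 2⁻¹ ^ k := by rw [← mul_pow]; norm_num
      _ ≤ 32⁻¹ ^ k * 2⁻¹ := by
          gcongr
          exact pow_le_of_le_one (by norm_num) (by norm_num) (by omega)
      _ = _ := (div_eq_mul_inv _ _).symm
  · refine (le_total n ⌊L / 6⌋₊).imp (fun h => min_eq_left h) fun h => ?_
    rw [min_eq_right h]
    have hfloor_one : (1 : ℝ) ≤ ⌊L / 6⌋₊ := by exact_mod_cast hfloor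
    linarith [Nat.lt_floor_add_one (L / 6)]

theorem exists_density (p : ℝ≥0∞) {m : ℕ} (hm : 1 ≤ m) : ∃ ρ : unitInterval, 1 ≤ m * (ρ : ℝ) ∧
    √(m * ρ) * (ρ : ℝ) ^ (-(1 / p.toReal)) = (m : ℝ) ^ (1 / (min p 2).toReal) := by
  have hm0 : (0 : ℝ) < m := by exact_mod_cast hm
  rcases le_total p 2 with hp2 | hp2
  · refine ⟨⟨(m : ℝ)⁻¹, by positivity, inv_le_one_of_one_le₀ (by exact_mod_cast hm)⟩, ?_, ?_⟩
    · exact (mul_inv_cancel₀ hm0.ne').ge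
    · rw [mul_inv_cancel₀ hm0.ne', Real.sqrt_one, one_mul, min_eq_left hp2,
        Real.inv_rpow hm0.le, Real.rpow_neg hm0.le, inv_inv]
  · refine ⟨1, by simpa using hm, ?_⟩
    rw [min_eq_right hp2]
    simp [Real.sqrt_eq_rpow]

theorem half_mul_rpow_le (hk : 1 ≤ k) (hkn : k ≤ n) {e : ℝ} (he : e ∈ Icc (0 : ℝ) 1) :
    ((k : ℝ) / n) ^ (1 - e) / 2 ≤ k / n * ((n / k : ℕ) : ℝ) ^ e := by
  have hk0 : (0 : ℝ) < k := by exact_mod_cast hk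
  have hn0 : (0 : ℝ) < n := by exact_mod_cast hk.trans hkn
  have hdiv : (n : ℝ) / k ≤ 2 * (n / k : ℕ) := by
    rw [div_le_iff₀ hk0]
    have hmod := Nat.div_add_mod n k
    have hlt := Nat.mod_lt n hk
    have hle : k ≤ k * (n / k) := Nat.le_mul_of_pos_right k (Nat.div_pos hkn hk)
    exact_mod_cast (by nlinarith : n ≤ 2 * (n / k) * k)
  have hpow : ((n : ℝ) / k) ^ e ≤ 2 * ((n / k : ℕ) : ℝ) ^ e :=
    (Real.rpow_le_rpow (by positivity) hdiv he.1).trans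
      (mul_rpow_le_mul_rpow one_le_two (Nat.cast_nonneg _) he)
  rw [Real.rpow_sub (by positivity), Real.rpow_one, div_eq_mul_inv _ (_ ^ e),
    ← Real.inv_rpow (by positivity), inv_div, mul_div_assoc]
  gcongr
  linarith

end Rate

section FoolingFamily

variable {d r n : ℕ} {p : ℝ≥0∞} {ι : Type*} [Fintype ι] {b : (Fin d → ℝ) → ℝ} {C h : ℝ}
  {c : ι → Fin d → ℝ}

theorem sobolevNorm_bumpSum_le [Nonempty ι] (hp : 1 ≤ p) (G : Set (Fin d → ℝ)) (hh : 0 < h)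
    (hh1 : h ≤ 1) (hb : ContDiff ℝ (⊤ : ℕ∞) b) (hb1 : tsupport b ⊆ Metric.closedBall 0 1)
    (hc : Pairwise fun i j => Disjoint (Metric.closedBall (c i) h) (Metric.closedBall (c j) h))
    (hC : ∀ w : List (Fin d), w.length ≤ r → ∀ x, |iteratedPartialD w b x| ≤ C)
    {K V : ℝ} {v : ι → ℝ} (hv : ∀ i, |v i| ≤ K) (hV : 0 < V)
    (hcard : (Finset.univ.filter (v · ≠ 0)).card * (2 * h) ^ d ≤ V) :
    sobolevNorm r p G (bumpSum b h c v) ≤ ENNReal.ofReal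
      ((multiIndices d r).card * (h⁻¹ ^ r * K * C * V ^ (1 / p.toReal))) := by
  have hB0 : 0 ≤ h⁻¹ ^ r * K * C := (abs_nonneg _).trans
    (abs_iteratedPartialD_bumpSum_le hh hh1 hb hb1 hc hC hv (w := []) (Nat.zero_le r) 0)
  rw [ENNReal.ofReal_mul (Nat.cast_nonneg _), ENNReal.ofReal_natCast, ENNReal.ofReal_mul hB0,
    ← ENNReal.ofReal_rpow_of_pos hV]
  refine (sobolevNorm_le hp G (contDiff_bumpSum hb h c v) fun w hw x =>
    abs_iteratedPartialD_bumpSum_le hh hh1 hb hb1 hc hC hv hw x).trans ?_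
  gcongr
  exact (volume_tsupport_bumpSum_le hh hb1 c v).trans (ENNReal.ofReal_le_ofReal hcard)

theorem card_filter_ne_zero_eq_signWeight (s : ι → SignType) :
    ((Finset.univ.filter fun i => (s i : ℝ) ≠ 0).card : ℝ) = signWeight Finset.univ s := by
  rw [signWeight, Finset.natCast_card_filter]
  refine Finset.sum_congr rfl fun i _ => ?_
  cases s i <;> simp

theorem sobolevNorm_bumpSum_sign_le_one [Nonempty ι] (hp : 1 ≤ p) (G : Set (Fin d → ℝ))
    (hh : 0 < h) (hh1 : h ≤ 1) (hb : ContDiff ℝ (⊤ : ℕ∞) b)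
    (hb1 : tsupport b ⊆ Metric.closedBall 0 1)
    (hc : Pairwise fun i j => Disjoint (Metric.closedBall (c i) h) (Metric.closedBall (c j) h))
    (hC0 : 0 < C) (hC : ∀ w : List (Fin d), w.length ≤ r → ∀ x, |iteratedPartialD w b x| ≤ C)
    {K ρ : ℝ} (hρ : 0 < ρ) (hK0 : 0 ≤ K)
    (hK : 256 * ((multiIndices d r).card * C) * K ≤ h ^ r * ρ ^ (-(1 / p.toReal)))
    {s : ι → SignType} (hs : signWeight Finset.univ s * (2 * h) ^ d ≤ 256 * ρ) :
    sobolevNorm r p G (bumpSum b h c fun i => K * (s i : ℝ)) ≤ 1 := by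
  have hv (i : ι) : |K * (s i : ℝ)| ≤ K := by
    rw [abs_mul, abs_of_nonneg hK0]
    exact mul_le_of_le_one_right hK0 (by cases s i <;> simp)
  have hcard : (Finset.univ.filter fun i => K * (s i : ℝ) ≠ 0).card * (2 * h) ^ d ≤ 256 * ρ := by
    have hsub : Finset.univ.filter (fun i => K * (s i : ℝ) ≠ 0) ⊆
        Finset.univ.filter fun i => (s i : ℝ) ≠ 0 :=
      Finset.monotone_filter_right _ fun i _ hi => right_ne_zero_of_mul hi
    refine le_trans ?_ hs
    rw [← card_filter_ne_zero_eq_signWeight]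
    gcongr
  refine (sobolevNorm_bumpSum_le hp G hh hh1 hb hb1 hc hC hv (by positivity) hcard).trans
    (ENNReal.ofReal_le_one.2 ?_)
  have hroot : (256 * ρ) ^ (1 / p.toReal) ≤ 256 * ρ ^ (1 / p.toReal) :=
    mul_rpow_le_mul_rpow (by norm_num) hρ.le (one_div_toReal_mem_Icc hp)
  calc (multiIndices d r).card * (h⁻¹ ^ r * K * C * (256 * ρ) ^ (1 / p.toReal))
      ≤ (multiIndices d r).card * (h⁻¹ ^ r * K * C * (256 * ρ ^ (1 / p.toReal))) := by gcongr
    _ = 256 * ((multiIndices d r).card * C) * K * (h⁻¹ ^ r * ρ ^ (1 / p.toReal)) := by ring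
    _ ≤ h ^ r * ρ ^ (-(1 / p.toReal)) * (h⁻¹ ^ r * ρ ^ (1 / p.toReal)) := by gcongr
    _ = 1 := by
        rw [Real.rpow_neg hρ.le, inv_pow]
        field_simp

theorem rpow_neg_inv_pow {x : ℝ} (hx : 0 ≤ x) (r d : ℕ) :
    (x ^ (-(d : ℝ)⁻¹)) ^ r = x ^ (-((r : ℝ) / d)) := by
  rw [← Real.rpow_natCast, ← Real.rpow_mul hx]
  congr 1
  ring

theorem exists_foolingFamily (hd : 1 ≤ d) (r : ℕ) {G : Set (Fin d → ℝ)}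
    (hG : (interior G).Nonempty) :
    ∃ c : ℝ, 0 < c ∧ ∀ p : ℝ≥0∞, 1 ≤ p → ∀ n : ℕ, 1 ≤ n → ∀ ρ : ℝ, 0 < ρ →
      ∃ (f : (Fin (2 * n) → SignType) → (Fin d → ℝ) → ℝ) (J : (Fin d → ℝ) → Fin (2 * n)),
        (∀ x s s', s' (J x) = s (J x) → f s' x = f s x) ∧
        ∀ s, signWeight Finset.univ s ≤ 256 * (n * ρ) →
          f s ∈ continuousSobolevSpace r p G ∧ sobolevNorm r p G (f s) ≤ 1 ∧
          ∫ x in G, f s x = c * ((n : ℝ) ^ (-((r : ℝ) / d)) / n * ρ ^ (-(1 / p.toReal))) *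
            signSum Finset.univ s := by
  obtain ⟨b, C, hb, hb1, hbpos, hC0, hC⟩ := exists_contDiff_bump d r
  obtain ⟨a, ha0, ha1, hpack⟩ := exists_packing hd isOpen_interior hG
  have hA0 : (0 : ℝ) < (multiIndices d r).card :=
    Nat.cast_pos.2 (Finset.card_pos.2 ⟨0, mem_multiIndices.2 (by simp)⟩)
  have hd0 : (d : ℝ) ≠ 0 := by positivity
  set A : ℝ := ((multiIndices d r).card : ℝ)
  refine ⟨a ^ (r + d) * 2 ^ (-((r : ℝ) / d)) / 2 * (∫ x, b x) / (256 * (A * C)), by positivity,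
    fun p hp n hn ρ hρ => ?_⟩
  have hn0 : (0 : ℝ) < n := by exact_mod_cast hn
  obtain ⟨c, hc, hcG⟩ := hpack (2 * n) (by omega)
  push_cast at hc hcG
  set y : ℝ := (2 * n : ℝ) ^ (-(d : ℝ)⁻¹)
  have hy0 : 0 < y := by positivity
  have hy1 : y ≤ 1 := Real.rpow_le_one_of_one_le_of_nonpos (by norm_cast; omega) (by simp)
  have hyd : y ^ d = (2 * n : ℝ)⁻¹ := by
    rw [rpow_neg_inv_pow (by positivity), div_self hd0, Real.rpow_neg_one]
  have hyr : y ^ r = 2 ^ (-((r : ℝ) / d)) * (n : ℝ) ^ (-((r : ℝ) / d)) := by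
    rw [rpow_neg_inv_pow (by positivity), Real.mul_rpow (by norm_num) hn0.le]
  set h := a * y
  have hh0 : 0 < h := by positivity
  have hh2 : 2 * h ≤ y := by nlinarith
  have : Nonempty (Fin (2 * n)) := Fin.pos_iff_nonempty.1 (by omega)
  choose J hJ using exists_bumpSum_eq hh0 hb1 hc
  set K := h ^ r * ρ ^ (-(1 / p.toReal)) / (256 * (A * C))
  refine ⟨fun s => bumpSum b h c fun i => K * (s i : ℝ), J, fun x s s' hs => ?_, fun s hs => ?_⟩
  · simp only [hJ, hs]
  have hnorm : sobolevNorm r p G (bumpSum b h c fun i => K * (s i : ℝ)) ≤ 1 := by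
    refine sobolevNorm_bumpSum_sign_le_one hp G hh0 (by linarith) hb hb1 hc hC0 hC hρ
      (by positivity) (mul_div_cancel₀ _ (by positivity)).le ?_
    calc signWeight Finset.univ s * (2 * h) ^ d ≤ 256 * (n * ρ) * y ^ d := by gcongr
      _ = 128 * ρ := by rw [hyd]; field_simp; norm_num
      _ ≤ 256 * ρ := by linarith
  refine ⟨mem_continuousSobolevSpace G (contDiff_bumpSum hb h c _)
    (hasCompactSupport_bumpSum hh0 hb1 c _) (hnorm.trans_lt ENNReal.one_lt_top), hnorm, ?_⟩
  rw [setIntegral_bumpSum hh0 hb.continuous hb1 _ fun i => (hcG i).trans interior_subset,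
    ← Finset.mul_sum, ← signSum]
  simp only [K, h, mul_pow, pow_add, hyd, hyr]
  field_simp

end FoolingFamily

section LowerBound

variable {d : ℕ} {G : Set (Fin d → ℝ)}

theorem exists_ofReal_rpow_le_probError (hd : 1 ≤ d) (r : ℕ) (hG : (interior G).Nonempty) :
    ∃ c : ℝ, 0 < c ∧ ∀ (p : ℝ≥0∞) (n k : ℕ) (δ : ℝ), 1 ≤ p → 1 ≤ k → k ≤ n →
      δ < 32⁻¹ ^ k / 2 →
      ENNReal.ofReal (c * ((n : ℝ) ^ (-((r : ℝ) / d)) *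
        ((k : ℝ) / n) ^ (1 - 1 / (min p 2).toReal))) ≤
        probError.{u} G n δ (continuousSobolevSpace r p G) (sobolevNorm r p G) := by
  obtain ⟨c, hc, hfool⟩ := exists_foolingFamily hd r hG
  refine ⟨c / 4, by positivity, fun p n k δ hp hk hkn hδ => ?_⟩
  have hn0 : (0 : ℝ) < n := by exact_mod_cast hk.trans hkn
  obtain ⟨ρ, hρm, hρ⟩ := exists_density p (Nat.div_pos hkn hk)
  have hρ0 : 0 < (ρ : ℝ) := ρ.2.1.lt_of_ne fun h => by
    rw [← h] at hρm
    linarith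
  obtain ⟨f, J, hlocal, hf⟩ := hfool p hp n (hk.trans hkn) ρ hρ0
  refine le_trans (ENNReal.ofReal_le_ofReal ?_) (ofReal_mul_le_probError_of_blocks
    (by simp) hk (Nat.mul_div_le n k) hρm hδ (by positivity) hlocal hf)
  have hblock := half_mul_rpow_le hk hkn (one_div_toReal_mem_Icc (le_min hp one_le_two))
  rw [← hρ] at hblock
  set X := (n : ℝ) ^ (-((r : ℝ) / d))
  calc c / 4 * (X * ((k : ℝ) / n) ^ (1 - 1 / (min p 2).toReal))
      = c * X / 2 * (((k : ℝ) / n) ^ (1 - 1 / (min p 2).toReal) / 2) := by ring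
    _ ≤ c * X / 2 * (k / n * (√((n / k : ℕ) * ρ) * (ρ : ℝ) ^ (-(1 / p.toReal)))) := by gcongr
    _ = _ := by ring

end LowerBound

/-- The asymptotic lower bound, for the space of all functions in `W_p^r(G)` and also for its
continuous members only (the case of continuous representatives). The threshold and the constants
depend on `d`, `r` and `G` only. -/
theorem mainTheorem2 (d : ℕ) (hd : 1 ≤ d) (r : ℕ) (G : Set (Fin d → ℝ))
    (hGm : NullMeasurableSet G volume) (hG : (interior G).Nonempty) :
    ∃ (n₀ : ℕ) (δ₀ c : ℝ), 0 < δ₀ ∧ δ₀ < 1 ∧ 0 < c ∧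
      ∀ p : ℝ≥0∞, 1 ≤ p → ∀ n : ℕ, n₀ ≤ n → ∀ δ : ℝ, 0 < δ → δ < δ₀ →
        ENNReal.ofReal (c * lowerRate d r p n δ) ≤
          probError.{u} G n δ (sobolevSpace r p G) (sobolevNorm r p G) ∧
        ENNReal.ofReal (c * lowerRate d r p n δ) ≤
          probError.{u} G n δ (continuousSobolevSpace r p G) (sobolevNorm r p G) := by
  obtain ⟨c, hc, hblocks⟩ := exists_ofReal_rpow_le_probError.{u} hd r hG
  refine ⟨1, Real.exp (-6), c / 12, Real.exp_pos _, Real.exp_lt_one_iff.2 (by norm_num),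
    by positivity,
    fun p hp n hn δ hδ hδ₀ => ?_⟩
  obtain ⟨k, hk, hkn, hδk, hkL⟩ := exists_block_count hn hδ hδ₀
  have hδ1 : δ ≤ 1 := hδ₀.le.trans (Real.exp_le_one_iff.2 (by norm_num))
  have hbound : ENNReal.ofReal (c / 12 * lowerRate d r p n δ) ≤
      probError.{u} G n δ (continuousSobolevSpace r p G) (sobolevNorm r p G) := by
    refine (ENNReal.ofReal_le_ofReal ?_).trans (hblocks p n k δ hp hk hkn hδk)
    linarith [mul_le_mul_of_nonneg_left (lowerRate_le (d := d) (r := r) hp hn hδ hδ1 hkL)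
      (show 0 ≤ c / 12 by positivity)]
  exact ⟨hbound.trans (probError_mono_space G n δ (fun f hf => hf.1) _), hbound⟩
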